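/- Let $k$ be a finite field, $F=k((t))$, $\mathcal O_F=k[[t]]$, $G=\mathrm{GL}_2$, $Z$ the center of $G(F)$, $\mathfrak M=M_2(\mathcal O_F)$ and $K=G(\mathcal O_F)$. All representations are on vector spaces over an algebraically closed field $C$ of characteristic $0$ (e.g. $\overline{\mathbb Q}_\ell$ with $\ell\ne\mathrm{char}\,k$). Let $m\ge 0$, let $K_m=G(\mathcal O_F/t^{m+1})$, and let $N_m^m\subseteq K_m$ be the group of matrices $\begin{pmatrix}1&u\\0&1\end{pmatrix}$ with $u\in t^m\mathcal O_F/t^{m+1}\mathcal O_F$. Notation. For an $\mathcal O_F$-lattice chain $\dots\supsetneq L_i\supsetneq L_{i+1}\supsetneq\dots$ in $F^2$ with $tL_i=L_{i+e}$, put $\mathfrak A=\{x\in M_2(F): xL_i\subseteq L_i\ \forall i\}$ (a chain order, with $e_{\mathfrak A}=e$), $\mathfrak P^n=\{x\in M_2(F): xL_i\subseteq L_{i+n}\ \forall i\}$ for $n\in\mathbb Z$, and $U_{\mathfrak A}^n=1+\mathfrak P^n$ for $n\ge1$. For an irreducible smooth representation $\pi$ of $G(F)$, the level $\ell(\pi)$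 is the minimum of $n/e_{\mathfrak A}$ over all chain orders $\mathfrak A$ and integers $n\ge 0$ such that $\pi$ has a nonzero vector fixed by $U_{\mathfrak A}^{n+1}$. A stratum is a triple $(\mathfrak A,n,a)$ with $n\ge1$ and $a\in\mathfrak P^{-n}$. Fix an additive character $\psi$ of $F$ of level one, i.e. trivial on $t\mathcal O_F$ but not on $\mathcal O_F$; $\pi$ contains $(\mathfrak A,n,a)$ if $U_{\mathfrak A}^n$ acts on some nonzero vector of $\pi$ by the character $x\mapsto\psi(\mathrm{tr}(a(x-1)))$. If $e_{\mathfrak A}=1$, let $\tilde f_a\in k[T]$ be the reduction modulo $t$ of the characteristic polynomial of $t^na\in\mathfrak A$; the stratum is unramified simple if $\tilde f_a$ is irreducible, and essentially scalar if $\tilde f_a=(T-\lambda)^2$ with $\lambda\in k^\times$. A smooth irreducible representation $V$ of $G(F)$ is cuspidal if $V$ is spanned by the vectors $nv-v$ with $v\in V$ and $n$ upper triangular unipotent. For a smooth character $\phi$ of $F^\times$, $\phi\pi$ denotes $g\mapsto\phi(\det g)\pi(g)$. Proposition. Let $\Xi$ be a representation of $ZK$ whose restriction to $K$ is the inflation of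 an irreducible representation $\xi$ of $K_m$ that does not contain the trivial character on $N_m^m$. Then $\Pi_\Xi=\text{c-Ind}_{ZK}^{G(F)}\Xi$ is irreducible, cuspidal and admissible. If $m>0$, then, for every $\psi$ of level one, $\Pi_\Xi$ contains an unramified simple stratum $(\mathfrak M,m,\alpha)$ for some $\alpha\in t^{-m}\mathfrak M$, and $\Pi_\Xi$ contains no essentially scalar stratum; moreover $\ell(\Pi_\Xi)=m$, and for every smooth character $\phi$ of $F^\times$ one has $0<\ell(\Pi_\Xi)\le\ell(\phi\Pi_\Xi)$. -/

import Mathlib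

open scoped LaurentSeries PowerSeries Pointwise MatrixGroups

noncomputable section

namespace GLTwo

/-! ### Smooth representations and compact induction -/

section Generic

variable {C G V W : Type*} [Field C] [Group G] [TopologicalSpace G]
  [AddCommGroup V] [Module C V] [AddCommGroup W] [Module C W]

/-- Every vector has an open stabilizer. -/
def IsSmooth (π : Representation C G V) : Prop :=
  ∀ v : V, IsOpen {g : G | π g v = v}

/-- The subspace of vectors fixed by a subgroup. -/
def fixedVectors (π : Representation C G V) (H : Subgroup G) : Submodule C V where
  carrier := {v | ∀ h ∈ H, π h v = v}
  add_mem' {v w} hv hw h hh := by rw [map_add, hv h hh, hw h hh]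
  zero_mem' h _ := map_zero _
  smul_mem' c v hv h hh := by rw [map_smul, hv h hh]

/-- Smooth, with finite-dimensional fixed spaces for all compact open subgroups. -/
structure IsAdmissible (π : Representation C G V) : Prop where
  smooth : IsSmooth π
  finite : ∀ H : Subgroup G, IsOpen (H : Set G) → IsCompact (H : Set G) →
    FiniteDimensional C (fixedVectors π H)

/-- The restriction of `π` to the subset (in practice: subgroup) `S` contains the
one-dimensional representation `θ`: some nonzero vector transforms under `S` by `θ`. -/
def ContainsCharOn {G : Type*} [Group G]
    (π : Representation C G V) (S : Set G) (θ : G → C) : Prop :=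
  ∃ v : V, v ≠ 0 ∧ ∀ g ∈ S, π g v = θ g • v

/-- The space of `c-Ind_H^G ρ`: functions `f : G → W` with `f (h g) = ρ h (f g)`, invariant under
right translation by some open subgroup, and compactly supported modulo `H`. -/
def cIndSpace [IsTopologicalGroup G] (H : Subgroup G) (ρ : Representation C H W) :
    Submodule C (G → W) where
  carrier := {f | (∀ (h : H) (g : G), f (h * g) = ρ h (f g)) ∧
    (∃ U : Subgroup G, IsOpen (U : Set G) ∧ ∀ u ∈ U, ∀ g, f (g * u) = f g) ∧
    (∃ D : Set G, IsCompact D ∧ Function.support f ⊆ (H : Set G) * D)}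
  add_mem' := by
    rintro f₁ f₂ ⟨a₁, ⟨U₁, o₁, b₁⟩, ⟨D₁, c₁, d₁⟩⟩ ⟨a₂, ⟨U₂, o₂, b₂⟩, ⟨D₂, c₂, d₂⟩⟩
    refine ⟨fun h g => ?_, ⟨U₁ ⊓ U₂, ?_, fun u hu g => ?_⟩, ⟨D₁ ∪ D₂, c₁.union c₂, ?_⟩⟩
    · simp only [Pi.add_apply, a₁, a₂, map_add]
    · rw [Subgroup.coe_inf]; exact o₁.inter o₂
    · simp only [Pi.add_apply, b₁ u hu.1, b₂ u hu.2]
    · rw [Set.mul_union]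
      exact (Function.support_add f₁ f₂).trans (Set.union_subset_union d₁ d₂)
  zero_mem' := by
    refine ⟨fun h g => ?_, ⟨⊤, ?_, fun u _ g => rfl⟩, ⟨∅, isCompact_empty, ?_⟩⟩
    · simp
    · simp
    · simp
  smul_mem' := by
    rintro c f ⟨a, ⟨U, o, b⟩, ⟨D, e, d⟩⟩
    refine ⟨fun h g => ?_, ⟨U, o, fun u hu g => ?_⟩, ⟨D, e, ?_⟩⟩
    · simp only [Pi.smul_apply, a, map_smul]
    · simp only [Pi.smul_apply, b u hu]
    · exact (Function.support_const_smul_subset c f).trans d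

lemma translate_mem_cIndSpace [IsTopologicalGroup G] (H : Subgroup G) (ρ : Representation C H W)
    (x : G) {f : G → W} (hf : f ∈ cIndSpace H ρ) : (fun g => f (g * x)) ∈ cIndSpace H ρ := by
  obtain ⟨a, ⟨U, o, b⟩, ⟨D, e, d⟩⟩ := hf
  refine ⟨fun h g => ?_, ⟨U.comap (MulAut.conj x⁻¹).toMonoidHom, ?_, fun u hu g => ?_⟩,
    ⟨(fun y => y * x⁻¹) '' D, e.image (by fun_prop), ?_⟩⟩
  · simp only [mul_assoc, a]
  · have hc : Continuous fun y : G => x⁻¹ * y * x⁻¹⁻¹ := by fun_prop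
    exact o.preimage hc
  · have := b _ hu (g * x)
    simpa [mul_assoc] using this
  · intro g hg
    obtain ⟨h, hh, y, hy, hxy⟩ := d (show g * x ∈ Function.support f from hg)
    exact ⟨h, hh, y * x⁻¹, ⟨y, hy, rfl⟩, by
      simp only at hxy ⊢; rw [← mul_assoc, hxy, mul_inv_cancel_right]⟩

/-- The compactly induced representation `c-Ind_H^G ρ`; `G` acts by right translation. -/
def cInd [IsTopologicalGroup G] (H : Subgroup G) (ρ : Representation C H W) :
    Representation C G (cIndSpace H ρ) where
  toFun x :=
    { toFun := fun f => ⟨fun g => f.1 (g * x), translate_mem_cIndSpace H ρ x f.2⟩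
      map_add' := fun _ _ => rfl
      map_smul' := fun _ _ => rfl }
  map_one' := by ext f g; simp
  map_mul' x y := by ext f g; simp [mul_assoc]

end Generic

/-! ### The group `GL₂(F)`, `F = k((t))`, and its subgroups -/

section Groups

variable (k : Type*) [Field k]

/-- The uniformizer `t` of `F = k((t))`. -/
def unif : k⸨X⸩ := algebraMap k⟦X⟧ k⸨X⸩ PowerSeries.X

/-- `K = GL₂(O_F)` as a subgroup of `GL₂(F)`. -/
def maxCompact : Subgroup (GL (Fin 2) k⸨X⸩) :=
  (Matrix.GeneralLinearGroup.map (n := Fin 2) (algebraMap k⟦X⟧ k⸨X⸩)).range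

/-- `ZK`, with `Z` the center of `GL₂(F)`. -/
def ZK : Subgroup (GL (Fin 2) k⸨X⸩) := Subgroup.center (GL (Fin 2) k⸨X⸩) ⊔ maxCompact k

/-- The embedding of `GL₂(O_F)` into `ZK`. -/
def toZK : GL (Fin 2) k⟦X⟧ →* ZK k :=
  (Subgroup.inclusion (le_sup_right : maxCompact k ≤ ZK k)).comp
    (Matrix.GeneralLinearGroup.map (n := Fin 2) (algebraMap k⟦X⟧ k⸨X⸩)).rangeRestrict

/-- `O_F / t^(m+1)`. -/
abbrev TruncRing (m : ℕ) : Type _ := k⟦X⟧ ⧸ Ideal.span {(PowerSeries.X : k⟦X⟧) ^ (m + 1)}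

/-- `K_m = GL₂(O_F / t^(m+1))`, which is `K / K^(m+1)`. -/
abbrev FiniteLevel (m : ℕ) : Type _ := GL (Fin 2) (TruncRing k m)

/-- Reduction modulo `t^(m+1)`. -/
def reduction (m : ℕ) : GL (Fin 2) k⟦X⟧ →* FiniteLevel k m :=
  Matrix.GeneralLinearGroup.map (Ideal.Quotient.mk _)

/-- `N_m^i`: the upper triangular unipotent matrices in `K_m` congruent to `1` modulo `t^i`. -/
def unipFiltration (m i : ℕ) : Set (FiniteLevel k m) :=
  {g | ∃ u ∈ Ideal.span {(Ideal.Quotient.mk _ PowerSeries.X : TruncRing k m) ^ i},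
    g = Matrix.GeneralLinearGroup.upperRightHom u}

end Groups

/-! ### Cuspidality and twisting -/

section Reps

variable {k C V : Type*} [Field k] [Field C] [AddCommGroup V] [Module C V]

/-- An irreducible smooth representation of `GL₂(F)` is cuspidal if its Jacquet module
`V / V(N)` vanishes; here `V(N)` is spanned by the vectors `π(n) v - v`, with `n` in the group
`N` of upper triangular unipotent matrices. -/
structure IsCuspidal (π : Representation C (GL (Fin 2) k⸨X⸩) V) : Prop where
  irreducible : π.IsIrreducible
  smooth : IsSmooth π
  jacquet : Submodule.span C {w : V | ∃ (x : k⸨X⸩) (v : V),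
    w = π (Matrix.GeneralLinearGroup.upperRightHom x) v - v} = ⊤

/-- The twist `φ π : g ↦ φ (det g) π g`. -/
def twist (φ : k⸨X⸩ˣ →* Cˣ) (π : Representation C (GL (Fin 2) k⸨X⸩) V) :
    Representation C (GL (Fin 2) k⸨X⸩) V where
  toFun g := (φ (Matrix.GeneralLinearGroup.det g) : C) • π g
  map_one' := by simp
  map_mul' g h := by
    ext v
    simp only [map_mul, Units.val_mul, LinearMap.smul_apply, Module.End.mul_apply, mul_smul,
      map_smul]
    exact smul_comm _ _ _

end Reps

/-! ### Lattice chains, strata and levels -/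

section Strata

/-- An `O_F`-lattice chain in `F²`, indexed by `ℤ`, with period `e`. -/
structure LatticeChain (k : Type*) [Field k] where
  L : ℤ → Submodule k⟦X⟧ (Fin 2 → k⸨X⸩)
  isLattice : ∀ i, Submodule.IsLattice k⸨X⸩ (L i)
  strictAnti : StrictAnti L
  e : ℕ
  period : ∀ i, (PowerSeries.X : k⟦X⟧) • L i = L (i + e)

variable {k : Type*} [Field k]

/-- For the chain order `𝔄 = {x | x L_i ⊆ L_i for all i}` with radical `𝔓`, this is
`𝔓^n = {x | x L_i ⊆ L_(i+n) for all i}`, for an integer `n`; in particular `𝔓^0 = 𝔄`. -/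
def LatticeChain.radPow (Λ : LatticeChain k) (n : ℤ) : Set (Matrix (Fin 2) (Fin 2) k⸨X⸩) :=
  {x | ∀ i, ∀ v ∈ Λ.L i, x.mulVec v ∈ Λ.L (i + n)}

/-- `U^n = 1 + 𝔓^n`, used for `n ≥ 1`. -/
def LatticeChain.unitGroup (Λ : LatticeChain k) (n : ℕ) : Set (GL (Fin 2) k⸨X⸩) :=
  {g | (g : Matrix (Fin 2) (Fin 2) k⸨X⸩) - 1 ∈ Λ.radPow n}

/-- `v ↦ t^i v`, from `O_F²` to `F²`. -/
def scaleMap (k : Type*) [Field k] (i : ℤ) : (Fin 2 → k⟦X⟧) →ₗ[k⟦X⟧] (Fin 2 → k⸨X⸩) where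
  toFun v j := unif k ^ i * algebraMap k⟦X⟧ k⸨X⸩ (v j)
  map_add' v w := by ext1 j; simp [mul_add]
  map_smul' c v := by
    ext1 j
    simp only [Pi.smul_apply, smul_eq_mul, map_mul, RingHom.id_apply, Algebra.smul_def]
    ring

lemma unif_ne_zero (k : Type*) [Field k] : unif k ≠ 0 := by
  unfold unif
  rw [Ne, FaithfulSMul.algebraMap_eq_zero_iff]
  exact PowerSeries.X_ne_zero

/-- The chain `L_i = t^i O_F²`, of period `1`; its chain order is `𝔐 = M₂(O_F)`, and
`𝔓^n = t^n 𝔐`. -/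
def stdChain (k : Type*) [Field k] : LatticeChain k where
  L i := LinearMap.range (scaleMap k i)
  isLattice i :=
    { fg := by
        rw [← Submodule.map_top]
        exact Submodule.FG.map _ Module.Finite.fg_top
      span_eq_top := by
        rw [eq_top_iff, ← (Pi.basisFun k⸨X⸩ (Fin 2)).span_eq, Submodule.span_le]
        rintro _ ⟨j, rfl⟩
        have h : scaleMap k i (Pi.single j 1) ∈
            Submodule.span k⸨X⸩ (LinearMap.range (scaleMap k i) : Set (Fin 2 → k⸨X⸩)) :=
          Submodule.subset_span ⟨_, rfl⟩
        have h2 := Submodule.smul_mem _ (unif k ^ i)⁻¹ h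
        have h3 : Pi.basisFun k⸨X⸩ (Fin 2) j =
            (unif k ^ i)⁻¹ • scaleMap k i (Pi.single j 1) := by
          ext1 l
          have ht := zpow_ne_zero i (unif_ne_zero k)
          by_cases hl : l = j
          · subst hl; simp [scaleMap, ht]
          · simp [scaleMap, hl]
        rw [h3]
        exact h2 }
  strictAnti := by
    refine strictAnti_int_of_succ_lt fun i => ?_
    have ht := unif_ne_zero k
    refine lt_of_le_of_ne ?_ fun h => ?_
    · rintro _ ⟨v, rfl⟩
      refine ⟨(PowerSeries.X : k⟦X⟧) • v, ?_⟩
      ext1 j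
      simp only [scaleMap, LinearMap.coe_mk, AddHom.coe_mk, Pi.smul_apply, smul_eq_mul, map_mul]
      rw [zpow_add_one₀ ht, unif]
      ring
    · have h1 : scaleMap k i (fun _ => 1) ∈ LinearMap.range (scaleMap k (i + 1)) := by
        rw [h]; exact ⟨_, rfl⟩
      obtain ⟨w, hw⟩ := h1
      have h0 := congrFun hw 0
      simp only [scaleMap, LinearMap.coe_mk, AddHom.coe_mk, zpow_add_one₀ ht, mul_assoc] at h0
      have h3 := mul_left_cancel₀ (zpow_ne_zero i ht) h0
      rw [unif, ← map_mul] at h3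
      have h4 := FaithfulSMul.algebraMap_injective k⟦X⟧ k⸨X⸩ h3
      have h5 := congrArg PowerSeries.constantCoeff h4
      simp at h5
  e := 1
  period i := by
    have ht := unif_ne_zero k
    ext x
    rw [Submodule.mem_smul_pointwise_iff_exists]
    constructor
    · rintro ⟨_, ⟨v, rfl⟩, rfl⟩
      refine ⟨v, ?_⟩
      ext1 j
      simp only [scaleMap, LinearMap.coe_mk, AddHom.coe_mk, Pi.smul_apply, Nat.cast_one,
        Algebra.smul_def]
      rw [zpow_add_one₀ ht, unif]
      ring
    · rintro ⟨v, rfl⟩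
      refine ⟨_, ⟨v, rfl⟩, ?_⟩
      ext1 j
      simp only [scaleMap, LinearMap.coe_mk, AddHom.coe_mk, Pi.smul_apply, Nat.cast_one,
        Algebra.smul_def]
      rw [zpow_add_one₀ ht, unif]
      ring

/-- A stratum `(𝔄, n, a)`: a chain order, given by its lattice chain, an integer `n ≥ 1`, and an
element `a ∈ 𝔓^(-n)`. -/
structure Stratum (k : Type*) [Field k] where
  chain : LatticeChain k
  n : ℕ
  n_pos : 0 < n
  a : Matrix (Fin 2) (Fin 2) k⸨X⸩
  mem : a ∈ chain.radPow (-n)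

/-- For a stratum with `e = 1`, the matrix `a₀ = t^n a` lies in `𝔄`, so that its characteristic
polynomial has coefficients in `O_F`. This says that `f` is the reduction of that polynomial
modulo `t`. -/
def Stratum.IsReducedCharpoly (s : Stratum k) (f : Polynomial k) : Prop :=
  ∃ F : Polynomial k⟦X⟧, F.map (algebraMap k⟦X⟧ k⸨X⸩) = (unif k ^ s.n • s.a).charpoly ∧
    f = F.map PowerSeries.constantCoeff

/-- Unramified simple: `e = 1` and the reduced characteristic polynomial is irreducible. -/
def Stratum.IsUnramifiedSimple (s : Stratum k) : Prop :=
  s.chain.e = 1 ∧ ∃ f : Polynomial k, s.IsReducedCharpoly f ∧ Irreducible f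

/-- Essentially scalar: `e = 1` and the reduced characteristic polynomial has a nonzero repeated
root in `k`. -/
def Stratum.IsEssentiallyScalar (s : Stratum k) : Prop :=
  s.chain.e = 1 ∧ ∃ c : k, c ≠ 0 ∧ s.IsReducedCharpoly ((Polynomial.X - Polynomial.C c) ^ 2)

variable {C V : Type*} [Field C] [AddCommGroup V] [Module C V]

/-- An additive character of `F` of level one: trivial on `t O_F` but not on `O_F`. -/
def IsLevelOne (ψ : AddChar k⸨X⸩ C) : Prop :=
  (∀ x : k⟦X⟧, ψ (algebraMap k⟦X⟧ k⸨X⸩ (PowerSeries.X * x)) = 1) ∧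
    ∃ x : k⟦X⟧, ψ (algebraMap k⟦X⟧ k⸨X⸩ x) ≠ 1

/-- `π` contains the stratum `(𝔄, n, a)` (with respect to `ψ`): its restriction to `U^n` contains
the character `ψ_a(x) = ψ (tr (a (x - 1)))`. -/
def ContainsStratum (ψ : AddChar k⸨X⸩ C) (π : Representation C (GL (Fin 2) k⸨X⸩) V)
    (s : Stratum k) : Prop :=
  ContainsCharOn π (s.chain.unitGroup s.n)
    (fun g => ψ (s.a * ((g : Matrix (Fin 2) (Fin 2) k⸨X⸩) - 1)).trace)

/-- `π` has normalized level `r`: `r` is the minimum of `n / e_𝔄` over all chain orders `𝔄` and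
integers `n ≥ 0` such that `π` contains the trivial character of `U^(n+1)`. -/
def HasLevel (π : Representation C (GL (Fin 2) k⸨X⸩) V) (r : ℚ) : Prop :=
  IsLeast {x : ℚ | ∃ (Λ : LatticeChain k) (n : ℕ),
    ContainsCharOn π (Λ.unitGroup (n + 1)) (fun _ => 1) ∧ x = (n : ℚ) / (Λ.e : ℚ)} r

end Strata

end GLTwo

end

/-! Everything rests on one observation. By `hN`, no nonzero vector of `W` is fixed by N_m^m, nor,
since K_m acts on `W`, by any K_m-conjugate of it. Left translation of the argument of `f` in c-Ind
by κnκ⁻¹ (κ in K, n in the preimage N^m of N_m^m) acts on the value `f g` through `ξ`, but it is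
also right translation by g⁻¹κnκ⁻¹g. If all these elements fix `f`, then `f g = 0`
(`cInd_eq_zero_of_forall_upperRightHom`).

For `f` fixed by the congruence subgroup modulo t^(n+1), the Cartan decomposition G = ⋃ ZK·diag(1,
t^j)·K reduces the question to g = diag(1, t^j)κ. Moving N^m through the diagonal matrix gives
N^(m+j), so `f` vanishes there once m + j ≥ n + 1 (`cInd_diagPow_eq_zero`). For n = m this confines
`f` to ZK: the invariants modulo t^(m+1) are just a copy of `W`. Averaging any nonzero vector of a
subrepresentation into this copy gives irreducibility. For general n, finitely many values determine
`f`, which gives admissibility. Cuspidality holds because the sum of ξ(n)w over N_m^m vanishes, so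
the copy of `W` lies in V(N); the Iwasawa decomposition extends this to its translates, which span.

For the level, every chain order contains, for given g, some g⁻¹κE₁₂κ⁻¹g with κ in K
(`LatticeChain.exists_conj_mem_unitGroup`). Hence U^(n+1) contains g⁻¹κN^mκ⁻¹g whenever n < m·e, and
the observation forces n ≥ m·e. The elements used have determinant one, so twists by characters of
the determinant obey the same bound (`le_of_containsCharOn`).

For m > 0, the group 1 + t^m M₂(k) is abelian and has an eigenvector in `W`, with character given by
a matrix `a` over k. An eigenvalue of `a` in k would make a conjugate of N_m^m fix that vector, so
the characteristic polynomial is irreducible (`IsLayerEigenvector.eval_charpoly_ne_zero`). An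
essentially scalar stratum is moved to the standard chain and excluded by comparing the two actions
on a nonzero value at diag(1, t^j) (`not_transform_of_charpoly_eq`). -/

open Matrix.GeneralLinearGroup (upperRightHom)

namespace GLTwo

local notation "ιO" => algebraMap (PowerSeries _) (LaurentSeries _)

/-! ### Fractional ideals of `F` and its topology -/

section Field

variable {k : Type*} [Field k]

/-- The fractional ideal `t^n O_F`. -/
def fracIdeal (k : Type*) [Field k] (n : ℤ) : Submodule k⟦X⟧ k⸨X⸩ where
  carrier := {x | ∃ y : k⟦X⟧, x = unif k ^ n * ιO y}
  add_mem' := by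
    rintro _ _ ⟨x, rfl⟩ ⟨y, rfl⟩
    exact ⟨x + y, by rw [map_add, mul_add]⟩
  zero_mem' := ⟨0, by simp⟩
  smul_mem' := by
    rintro c _ ⟨y, rfl⟩
    exact ⟨c * y, by rw [Algebra.smul_def, map_mul]; ring⟩

lemma mem_fracIdeal {n : ℤ} {x : k⸨X⸩} :
    x ∈ fracIdeal k n ↔ ∃ y : k⟦X⟧, x = unif k ^ n * ιO y := Iff.rfl

lemma algebraMap_X_pow (n : ℕ) : ιO ((PowerSeries.X : k⟦X⟧) ^ n) = unif k ^ (n : ℤ) := by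
  rw [map_pow, zpow_natCast]; rfl

lemma algebraMap_int_injective : Function.Injective (algebraMap k⟦X⟧ k⸨X⸩) :=
  FaithfulSMul.algebraMap_injective _ _

lemma mem_fracIdeal_zero {x : k⸨X⸩} : x ∈ fracIdeal k 0 ↔ ∃ y : k⟦X⟧, x = ιO y := by
  simp [mem_fracIdeal]

lemma algebraMap_mem_fracIdeal_natCast {n : ℕ} {y : k⟦X⟧} :
    ιO y ∈ fracIdeal k n ↔ PowerSeries.X ^ n ∣ y := by
  constructor
  · rintro ⟨z, hz⟩
    rw [← algebraMap_X_pow, ← map_mul] at hz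
    exact ⟨z, algebraMap_int_injective hz⟩
  · rintro ⟨z, rfl⟩
    exact ⟨z, by rw [map_mul, algebraMap_X_pow]⟩

lemma algebraMap_mem_fracIdeal_one {y : k⟦X⟧} :
    ιO y ∈ fracIdeal k 1 ↔ PowerSeries.constantCoeff y = 0 := by
  have := algebraMap_mem_fracIdeal_natCast (n := 1) (y := y)
  rw [Nat.cast_one, pow_one, PowerSeries.X_dvd_iff] at this
  exact this

lemma fracIdeal_antitone : Antitone (fracIdeal k) := by
  rintro a b hab _ ⟨y, rfl⟩
  obtain ⟨d, rfl⟩ := Int.le.dest hab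
  refine ⟨PowerSeries.X ^ d * y, ?_⟩
  rw [map_mul, algebraMap_X_pow, zpow_add₀ (unif_ne_zero k), mul_assoc]

lemma mul_mem_fracIdeal {a b : ℤ} {x y : k⸨X⸩} (hx : x ∈ fracIdeal k a)
    (hy : y ∈ fracIdeal k b) : x * y ∈ fracIdeal k (a + b) := by
  obtain ⟨x, rfl⟩ := hx
  obtain ⟨y, rfl⟩ := hy
  exact ⟨x * y, by rw [map_mul, zpow_add₀ (unif_ne_zero k)]; ring⟩

lemma unif_zpow_mem_fracIdeal (n : ℤ) : unif k ^ n ∈ fracIdeal k n := ⟨1, by simp⟩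

lemma unif_zpow_mul_mem_fracIdeal {a b : ℤ} {x : k⸨X⸩} :
    unif k ^ a * x ∈ fracIdeal k b ↔ x ∈ fracIdeal k (b - a) := by
  constructor
  · intro h
    have h1 := mul_mem_fracIdeal (unif_zpow_mem_fracIdeal (-a)) h
    rwa [← mul_assoc, ← zpow_add₀ (unif_ne_zero k), neg_add_cancel, zpow_zero, one_mul,
      neg_add_eq_sub] at h1
  · intro h
    simpa using mul_mem_fracIdeal (unif_zpow_mem_fracIdeal a) h

lemma exists_mem_fracIdeal (x : k⸨X⸩) : ∃ n, x ∈ fracIdeal k n := by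
  refine ⟨x.order, x.powerSeriesPart, ?_⟩
  rw [unif, LaurentSeries.coe_algebraMap, HahnSeries.ofPowerSeries_X, ← RatFunc.single_zpow]
  exact x.single_order_mul_powerSeriesPart.symm

lemma exists_unit_mul_X_pow {y : k⟦X⟧} (hy : y ≠ 0) :
    ∃ (n : ℕ) (u : k⟦X⟧ˣ), y = (u : k⟦X⟧) * (PowerSeries.X : k⟦X⟧) ^ n :=
  IsDiscreteValuationRing.eq_unit_mul_pow_irreducible hy PowerSeries.X_irreducible

lemma exists_eq_unif_zpow_mul_unit {x : k⸨X⸩} (hx : x ≠ 0) :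
    ∃ (n : ℤ) (u : k⟦X⟧ˣ), x = unif k ^ n * ιO (u : k⟦X⟧) := by
  obtain ⟨n, y, rfl⟩ := exists_mem_fracIdeal x
  have hy : y ≠ 0 := by rintro rfl; simp at hx
  obtain ⟨d, u, rfl⟩ := exists_unit_mul_X_pow hy
  exact ⟨n + d, u, by rw [zpow_add₀ (unif_ne_zero k), map_mul, algebraMap_X_pow]; ring⟩

lemma exists_notMem_fracIdeal {x : k⸨X⸩} (hx : x ≠ 0) : ∃ n, x ∉ fracIdeal k n := by
  obtain ⟨n, u, rfl⟩ := exists_eq_unif_zpow_mul_unit hx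
  refine ⟨n + 1, ?_⟩
  rw [unif_zpow_mul_mem_fracIdeal, add_sub_cancel_left, algebraMap_mem_fracIdeal_one]
  exact (PowerSeries.isUnit_iff_constantCoeff.1 u.isUnit).ne_zero

lemma valuation_le_one_iff {x : k⸨X⸩} : Valued.v x ≤ 1 ↔ ∃ y : k⟦X⟧, x = ιO y := by
  rw [LaurentSeries.val_le_one_iff_eq_coe]
  exact ⟨fun ⟨y, h⟩ => ⟨y, h.symm⟩, fun ⟨y, h⟩ => ⟨y, h.symm⟩⟩

lemma exists_eq_algebraMap_mul {x y : k⸨X⸩} (hx : x ≠ 0) (h : Valued.v y ≤ Valued.v x) :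
    ∃ c : k⟦X⟧, y = ιO c * x := by
  have h1 : Valued.v (y / x) ≤ 1 := by
    rw [map_div₀]
    exact div_le_one_of_le₀ h zero_le
  obtain ⟨c, hc⟩ := valuation_le_one_iff.1 h1
  exact ⟨c, by rw [← hc, div_mul_cancel₀ _ hx]⟩

lemma isOpen_fracIdeal (n : ℤ) : IsOpen (fracIdeal k n : Set k⸨X⸩) := by
  have h0 : IsOpen {x : k⸨X⸩ | Valued.v x ≤ 1} := Valued.isOpen_integer k⸨X⸩
  have hc : Continuous fun x : k⸨X⸩ => unif k ^ (-n) * x := by fun_prop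
  convert h0.preimage hc using 1
  ext x
  rw [Set.mem_preimage, Set.mem_ofPred_eq, valuation_le_one_iff, ← mem_fracIdeal_zero,
    unif_zpow_mul_mem_fracIdeal, zero_sub, neg_neg]
  rfl

lemma exists_fracIdeal_subset {s : Set k⸨X⸩} (hs : s ∈ nhds (0 : k⸨X⸩)) :
    ∃ n : ℕ, (fracIdeal k n : Set k⸨X⸩) ⊆ s := by
  obtain ⟨γ, hγ⟩ := Valued.mem_nhds_zero.1 hs
  have hγ0 : MonoidWithZeroHom.ValueGroup₀.embedding γ.1 ≠ 0 := by simp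
  obtain ⟨n, hn⟩ : ∃ n : ℕ, WithZero.exp (-(n : ℤ)) <
      MonoidWithZeroHom.ValueGroup₀.embedding γ.1 := by
    refine ⟨(1 - WithZero.log (MonoidWithZeroHom.ValueGroup₀.embedding γ.1)).toNat, ?_⟩
    rw [← WithZero.lt_log_iff_exp_lt hγ0]
    omega
  refine ⟨n, ?_⟩
  rintro _ ⟨y, rfl⟩
  apply hγ
  rw [Set.mem_ofPred_eq, Valuation.restrict_lt_iff_lt_embedding]
  refine lt_of_le_of_lt ?_ hn
  rw [map_mul, zpow_natCast]
  have h1 : Valued.v (ιO y : k⸨X⸩) ≤ 1 := valuation_le_one_iff.2 ⟨y, rfl⟩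
  have h2 : Valued.v (unif k ^ n) = WithZero.exp (-(n : ℤ)) := LaurentSeries.valuation_X_pow k n
  rw [h2]
  exact mul_le_of_le_one_right' h1

end Field

/-! ### Decompositions of `GL₂(F)` -/

section Decompositions

variable {k : Type*} [Field k]

/-- The embedding of `GL₂(O_F)` into `GL₂(F)`. -/
noncomputable abbrev toGL (k : Type*) [Field k] : GL (Fin 2) k⟦X⟧ →* GL (Fin 2) k⸨X⸩ :=
  Matrix.GeneralLinearGroup.map (n := Fin 2) (algebraMap k⟦X⟧ k⸨X⸩)

lemma coe_toZK (κ : GL (Fin 2) k⟦X⟧) : (toZK k κ : GL (Fin 2) k⸨X⸩) = toGL k κ := rfl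

lemma coe_toGL (κ : GL (Fin 2) k⟦X⟧) :
    (toGL k κ : Matrix (Fin 2) (Fin 2) k⸨X⸩) = (κ : Matrix (Fin 2) (Fin 2) k⟦X⟧).map ιO := rfl

lemma toGL_mem_ZK (κ : GL (Fin 2) k⟦X⟧) : toGL k κ ∈ ZK k := (toZK k κ).2

lemma toGL_upperRightHom (y : k⟦X⟧) : toGL k (upperRightHom y) = upperRightHom (ιO y) := by
  refine Units.ext (Matrix.ext fun i j => ?_)
  fin_cases i <;> fin_cases j <;> simp

/-- The diagonal matrix with entries `1, t^j`. -/
noncomputable def diagPow (k : Type*) [Field k] (j : ℕ) : GL (Fin 2) k⸨X⸩ :=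
  Matrix.GeneralLinearGroup.mkOfDetNeZero !![1, 0; 0, unif k ^ j]
    (by simp [Matrix.det_fin_two, unif_ne_zero])

lemma coe_diagPow (j : ℕ) :
    (diagPow k j : Matrix (Fin 2) (Fin 2) k⸨X⸩) = !![1, 0; 0, unif k ^ j] := rfl

lemma diagPow_zero : diagPow k 0 = 1 := by
  refine Units.ext (Matrix.ext fun i j => ?_)
  fin_cases i <;> fin_cases j <;> simp [coe_diagPow]

/-- The matrix exchanging the two basis vectors. -/
def swapGL (R : Type*) [CommRing R] : GL (Fin 2) R :=
  ⟨!![0, 1; 1, 0], !![0, 1; 1, 0], by simp [Matrix.one_fin_two], by simp [Matrix.one_fin_two]⟩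

/-- Lower triangular unipotent matrices. -/
def lowerLeft {R : Type*} [CommRing R] (x : R) : GL (Fin 2) R :=
  ⟨!![1, 0; x, 1], !![1, 0; -x, 1], by simp [Matrix.one_fin_two], by simp [Matrix.one_fin_two]⟩

/-- Iwasawa decomposition: the bottom entry of larger absolute value divides the other one over O_F,
so an integral column operation clears the lower left corner, after a swap if necessary. -/
lemma exists_upperTriangular (g : GL (Fin 2) k⸨X⸩) :
    ∃ κ : GL (Fin 2) k⟦X⟧, (g * toGL k κ) 1 0 = 0 := by
  have hdet : g.1.det ≠ 0 := g.det.ne_zero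
  rw [Matrix.det_fin_two] at hdet
  rcases le_total (Valued.v (g 1 0)) (Valued.v (g 1 1)) with h | h
  · have h0 : g 1 1 ≠ 0 := by
      intro h0
      rw [h0, map_zero, le_zero_iff, map_eq_zero] at h
      simp [h, h0] at hdet
    obtain ⟨c, hc⟩ := exists_eq_algebraMap_mul h0 h
    refine ⟨lowerLeft (-c), ?_⟩
    simp [Matrix.mul_apply, Fin.sum_univ_two, lowerLeft, hc]
    ring
  · have h0 : g 1 0 ≠ 0 := by
      intro h0
      rw [h0, map_zero, le_zero_iff, map_eq_zero] at h
      simp [h, h0] at hdet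
    obtain ⟨c, hc⟩ := exists_eq_algebraMap_mul h0 h
    refine ⟨swapGL _ * lowerLeft (-c), ?_⟩
    simp [Matrix.mul_apply, Fin.sum_univ_two, lowerLeft, swapGL, hc]
    ring

/-- Addition in `Fin 2` encodes the exchange of rows or columns; this brings the entry (p, q) to the
corner (0, 0). -/
lemma exists_swap_mul_mul_swap {K : Type*} [Field K] (g : GL (Fin 2) K) (p q : Fin 2) :
    ∃ a b : Bool, ∀ i j, (((if a then swapGL K else 1) * g * (if b then swapGL K else 1) :
      GL (Fin 2) K) i j = g (i + p) (j + q)) := by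
  refine ⟨p == 1, q == 1, fun i j => ?_⟩
  fin_cases p <;> fin_cases q <;> fin_cases i <;> fin_cases j <;>
    simp [swapGL, Matrix.mul_apply, Matrix.vecMul, dotProduct, Fin.sum_univ_two]

lemma eq_scalar_mul_lower_mul_diag_mul_upper {R : Type*} [CommRing R]
    {g : Matrix (Fin 2) (Fin 2) R} {b c u τ : R} (hb : g 0 1 = b * g 0 0) (hc : g 1 0 = c * g 0 0)
    (hd : g 1 1 = (u * τ + c * b) * g 0 0) :
    g = !![g 0 0, 0; 0, g 0 0] * !![1, 0; c, u] * !![1, 0; 0, τ] * !![1, b; 0, 1] := by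
  refine Matrix.ext fun i j => ?_
  fin_cases i <;> fin_cases j <;> simp [hb, hc, hd] <;> ring

/-- After division by the dominant entry the matrix is integral with corner 1. Clearing its row and
column leaves `d - c * b`, which is a unit times t^j. -/
lemma exists_diag_of_maximal_entry (g : GL (Fin 2) k⸨X⸩)
    (hg : ∀ i j, Valued.v (g i j) ≤ Valued.v (g 0 0)) :
    ∃ ζ ∈ ZK k, ∃ (j : ℕ) (κ : GL (Fin 2) k⟦X⟧), g = ζ * diagPow k j * toGL k κ := by
  have hdet : g.1.det ≠ 0 := g.det.ne_zero
  rw [Matrix.det_fin_two] at hdet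
  have h0 : g 0 0 ≠ 0 := by
    intro h0
    have h01 := hg 0 1
    rw [h0, map_zero, le_zero_iff, map_eq_zero] at h01
    simp [h0, h01] at hdet
  obtain ⟨b, hb⟩ := exists_eq_algebraMap_mul h0 (hg 0 1)
  obtain ⟨c, hc⟩ := exists_eq_algebraMap_mul h0 (hg 1 0)
  obtain ⟨d, hd⟩ := exists_eq_algebraMap_mul h0 (hg 1 1)
  have hδ : d - c * b ≠ 0 := by
    intro h
    apply hdet
    have h2 : d = c * b := sub_eq_zero.1 h
    rw [hb, hc, hd, h2, map_mul]
    ring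
  obtain ⟨j, u, hu⟩ := exists_unit_mul_X_pow hδ
  let z : GL (Fin 2) k⸨X⸩ := Matrix.GeneralLinearGroup.mkOfDetNeZero !![g 0 0, 0; 0, g 0 0]
    (by simpa [Matrix.det_fin_two] using h0)
  have hz : z ∈ Subgroup.center (GL (Fin 2) k⸨X⸩) := by
    rw [Matrix.GeneralLinearGroup.mem_center_iff_val_mem_range_scalar]
    refine ⟨g 0 0, ?_⟩
    refine Matrix.ext fun i j => ?_
    change _ = !![g 0 0, 0; 0, g 0 0] i j
    fin_cases i <;> fin_cases j <;> simp
  let κ₁ : GL (Fin 2) k⟦X⟧ := Matrix.GeneralLinearGroup.mk'' !![1, 0; c, (u : k⟦X⟧)]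
    (by simp [Matrix.det_fin_two])
  refine ⟨z * toGL k κ₁, (ZK k).mul_mem (Subgroup.mem_sup_left hz) (toGL_mem_ZK _), j,
    upperRightHom b, ?_⟩
  have hu' : ιO d = ιO (u : k⟦X⟧) * unif k ^ j + ιO c * ιO b := by
    have := congrArg (ιO : k⟦X⟧ → k⸨X⸩) (sub_eq_iff_eq_add.1 hu)
    rw [this, map_add, map_mul, map_mul, algebraMap_X_pow, zpow_natCast]
  have key : g.1 = !![g 0 0, 0; 0, g 0 0] * !![1, 0; ιO c, ιO (u : k⟦X⟧)] *
      !![1, 0; 0, unif k ^ j] * !![1, ιO b; 0, 1] := by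
    exact eq_scalar_mul_lower_mul_diag_mul_upper hb hc (by rw [hd, hu'])
  have hκ₁ : (toGL k κ₁).1 = !![1, 0; ιO c, ιO (u : k⟦X⟧)] := by
    refine Matrix.ext fun i j => ?_
    rw [Matrix.GeneralLinearGroup.map_apply]
    change ιO (!![1, 0; c, (u : k⟦X⟧)] i j) = _
    fin_cases i <;> fin_cases j <;> simp
  refine Units.ext (key.trans ?_)
  rw [toGL_upperRightHom, Units.val_mul, Units.val_mul, Units.val_mul, hκ₁]
  rfl

lemma toGL_swapGL : toGL k (swapGL _) = swapGL _ := by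
  refine Units.ext (Matrix.ext fun i j => ?_)
  fin_cases i <;> fin_cases j <;> simp [swapGL]

lemma swapGL_mul_self (R : Type*) [CommRing R] : swapGL R * swapGL R = 1 := by
  ext1
  simp [swapGL, Matrix.one_fin_two]

/-- The Cartan decomposition. -/
lemma exists_cartan (g : GL (Fin 2) k⸨X⸩) :
    ∃ ζ ∈ ZK k, ∃ (j : ℕ) (κ : GL (Fin 2) k⟦X⟧), g = ζ * diagPow k j * toGL k κ := by
  obtain ⟨⟨p, q⟩, hpq⟩ :=
    Finite.exists_max fun r : Fin 2 × Fin 2 => Valued.v (g r.1 r.2)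
  obtain ⟨a, b, hab⟩ := exists_swap_mul_mul_swap g p q
  have hs : ∀ a : Bool, ∃ κ : GL (Fin 2) k⟦X⟧, κ * κ = 1 ∧
      (if a then swapGL k⸨X⸩ else 1) = toGL k κ := by
    rintro (_ | _)
    · exact ⟨1, by simp, by simp⟩
    · exact ⟨swapGL _, swapGL_mul_self _, by simp [toGL_swapGL]⟩
  obtain ⟨κa, ha, ha'⟩ := hs a
  obtain ⟨κb, hb, hb'⟩ := hs b
  rw [ha', hb'] at hab
  obtain ⟨ζ, hζ, j, κ, h⟩ := exists_diag_of_maximal_entry (toGL k κa * g * toGL k κb) (by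
    intro i j
    rw [hab, hab, zero_add, zero_add]
    exact hpq (_, _))
  refine ⟨toGL k κa * ζ, (ZK k).mul_mem (toGL_mem_ZK _) hζ, j, κ * κb, ?_⟩
  have h1 : toGL k κa * toGL k κa = 1 := by rw [← map_mul, ha, map_one]
  have h2 : toGL k κb * toGL k κb = 1 := by rw [← map_mul, hb, map_one]
  calc g = toGL k κa * (toGL k κa * g * toGL k κb) * toGL k κb := by
        rw [mul_assoc, mul_assoc, h2, mul_one, ← mul_assoc, h1, one_mul]
    _ = _ := by rw [h, map_mul]; simp only [mul_assoc]

lemma toGL_lowerLeft (y : k⟦X⟧) : toGL k (lowerLeft y) = lowerLeft (ιO y) := by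
  refine Units.ext (Matrix.ext fun i j => ?_)
  fin_cases i <;> fin_cases j <;> simp [lowerLeft]

/-- Moving to the right through diag(1, t^j), upper unipotents go j steps deeper into the congruence
filtration; by the companion below, lower unipotents do so when moving to the left. -/
lemma upperRightHom_mul_diagPow (x : k⸨X⸩) (j : ℕ) :
    upperRightHom x * diagPow k j = diagPow k j * upperRightHom (x * unif k ^ j) := by
  refine Units.ext (Matrix.ext fun i l => ?_)
  fin_cases i <;> fin_cases l <;> simp [coe_diagPow]

lemma lowerLeft_mul_diagPow (x : k⸨X⸩) (j : ℕ) :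
    lowerLeft (unif k ^ j * x) * diagPow k j = diagPow k j * lowerLeft x := by
  refine Units.ext (Matrix.ext fun i l => ?_)
  fin_cases i <;> fin_cases l <;> simp [coe_diagPow, lowerLeft]

end Decompositions

/-! ### Congruence subgroups -/

section Congruence

variable {k : Type*} [Field k]

lemma reduction_eq_iff {m : ℕ} {κ κ' : GL (Fin 2) k⟦X⟧} :
    reduction k m κ = reduction k m κ' ↔
      ∀ i j, (PowerSeries.X : k⟦X⟧) ^ (m + 1) ∣ κ i j - κ' i j := by
  rw [Units.ext_iff, ← Matrix.ext_iff]
  refine forall₂_congr fun i j => ?_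
  rw [← Ideal.mem_span_singleton, ← Ideal.Quotient.eq]
  rfl

/-- The image in `GL₂(F)` of the principal congruence subgroup modulo `t^(n+1)`. -/
noncomputable def congruenceSubgroup (k : Type*) [Field k] (n : ℕ) : Subgroup (GL (Fin 2) k⸨X⸩) :=
  (reduction k n).ker.map (toGL k)

lemma exists_toGL_eq {n : ℕ} (hn : 0 < n) (g : GL (Fin 2) k⸨X⸩)
    (hg : ∀ i j, (g.1 - 1) i j ∈ fracIdeal k n) :
    ∃ (B : Matrix (Fin 2) (Fin 2) k⟦X⟧) (κ : GL (Fin 2) k⟦X⟧),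
      κ.1 = 1 + (PowerSeries.X : k⟦X⟧) ^ n • B ∧ toGL k κ = g := by
  choose B hB using hg
  let A : Matrix (Fin 2) (Fin 2) k⟦X⟧ := 1 + (PowerSeries.X : k⟦X⟧) ^ n • Matrix.of B
  have hA : IsUnit A.det := by
    rw [PowerSeries.isUnit_iff_constantCoeff, Matrix.det_fin_two]
    simp [A, hn.ne']
  refine ⟨Matrix.of B, Matrix.GeneralLinearGroup.mk'' A hA, rfl, ?_⟩
  refine Units.ext (Matrix.ext fun i j => ?_)
  have h := hB i j
  rw [Matrix.sub_apply, sub_eq_iff_eq_add] at h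
  rw [h, Matrix.GeneralLinearGroup.map_apply]
  change algebraMap k⟦X⟧ k⸨X⸩ (A i j) = _
  simp only [A, Matrix.add_apply, Matrix.smul_apply, Matrix.of_apply, map_add, smul_eq_mul,
    map_mul, algebraMap_X_pow]
  rw [add_comm]
  congr 1
  rw [Matrix.one_apply, Matrix.one_apply]
  split_ifs <;> simp

lemma mem_congruenceSubgroup {n : ℕ} {g : GL (Fin 2) k⸨X⸩} :
    g ∈ congruenceSubgroup k n ↔ ∀ i j, (g.1 - 1) i j ∈ fracIdeal k (n + 1 : ℕ) := by
  constructor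
  · rintro ⟨κ, hκ, rfl⟩ i j
    have h : reduction k n κ = reduction k n 1 := by rw [map_one]; exact hκ
    rw [reduction_eq_iff] at h
    have h' := algebraMap_mem_fracIdeal_natCast.2 (h i j)
    convert h' using 1
    rw [map_sub, Matrix.sub_apply, Matrix.GeneralLinearGroup.map_apply]
    congr 1
    change (1 : Matrix (Fin 2) (Fin 2) k⸨X⸩) i j = ιO ((1 : Matrix (Fin 2) (Fin 2) k⟦X⟧) i j)
    rw [Matrix.one_apply, Matrix.one_apply]
    split_ifs <;> simp
  · intro h
    obtain ⟨B, κ, hκ, rfl⟩ := exists_toGL_eq n.succ_pos g h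
    refine ⟨κ, ?_, rfl⟩
    change reduction k n κ = 1
    rw [← map_one (reduction k n), reduction_eq_iff]
    intro i j
    rw [hκ]
    exact ⟨B i j, by simp⟩

lemma isOpen_congruenceSubgroup (n : ℕ) :
    IsOpen (congruenceSubgroup k n : Set (GL (Fin 2) k⸨X⸩)) := by
  have : (congruenceSubgroup k n : Set (GL (Fin 2) k⸨X⸩)) =
      ⋂ i, ⋂ j, (fun g : GL (Fin 2) k⸨X⸩ => (g.1 - 1) i j) ⁻¹'
        (fracIdeal k (n + 1 : ℕ) : Set k⸨X⸩) := by
    ext g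
    simp only [Set.mem_iInter, Set.mem_preimage, SetLike.mem_coe, mem_congruenceSubgroup]
  rw [this]
  refine isOpen_iInter_of_finite fun i => isOpen_iInter_of_finite fun j => ?_
  refine (isOpen_fracIdeal _).preimage ?_
  have h1 : Continuous fun g : GL (Fin 2) k⸨X⸩ => g.1 - 1 :=
    Units.continuous_val.sub continuous_const
  exact h1.matrix_elem i j

lemma congruenceSubgroup_antitone : Antitone (congruenceSubgroup k) := by
  intro a b hab g hg
  rw [mem_congruenceSubgroup] at hg ⊢
  exact fun i j => fracIdeal_antitone (by exact_mod_cast Nat.succ_le_succ hab) (hg i j)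

lemma congruenceSubgroup_le_ZK (n : ℕ) : congruenceSubgroup k n ≤ ZK k := by
  rintro _ ⟨κ, -, rfl⟩
  exact toGL_mem_ZK κ

lemma isOpen_ZK : IsOpen (ZK k : Set (GL (Fin 2) k⸨X⸩)) :=
  Subgroup.isOpen_mono (congruenceSubgroup_le_ZK 0) (isOpen_congruenceSubgroup 0)

lemma exists_fracIdeal_matrix_subset {s : Set (Matrix (Fin 2) (Fin 2) k⸨X⸩)} (hs : s ∈ nhds 1) :
    ∃ n : ℕ, ∀ A : Matrix (Fin 2) (Fin 2) k⸨X⸩, (∀ i j, (A - 1) i j ∈ fracIdeal k n) → A ∈ s := by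
  have hc : Filter.Tendsto (fun A : Matrix (Fin 2) (Fin 2) k⸨X⸩ => A + 1) (nhds 0) (nhds 1) := by
    have h : Continuous (fun A : Matrix (Fin 2) (Fin 2) k⸨X⸩ => A + 1) := by fun_prop
    simpa using h.tendsto 0
  have h0 := hc hs
  rw [Filter.mem_map] at h0
  have h0' : {A : Fin 2 → Fin 2 → k⸨X⸩ | Matrix.of A + 1 ∈ s} ∈
      nhds (0 : Fin 2 → Fin 2 → k⸨X⸩) := h0
  rw [nhds_pi, Filter.mem_pi'] at h0'
  obtain ⟨I, t, ht, hI⟩ := h0'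
  have ht2 : ∀ i, ∃ (J : Finset (Fin 2)) (u : Fin 2 → Set k⸨X⸩), (∀ j, u j ∈ nhds (0 : k⸨X⸩)) ∧
      Set.pi J u ⊆ t i := by
    intro i
    have := ht i
    change _ ∈ nhds (0 : Fin 2 → k⸨X⸩) at this
    rw [nhds_pi, Filter.mem_pi'] at this
    exact this
  choose J u hu hJ using ht2
  choose N hN using fun i j => exists_fracIdeal_subset (hu i j)
  -- The sum is a convenient exponent dominating all four entrywise exponents.
  refine ⟨∑ i, ∑ j, N i j, fun A hA => ?_⟩
  have hA1 : A = (A - 1) + 1 := by simp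
  rw [hA1]
  refine hI fun i _ => hJ i fun j _ => hN i j ?_
  refine fracIdeal_antitone ?_ (hA i j)
  exact_mod_cast (Finset.single_le_sum (f := fun j => N i j) (fun _ _ => Nat.zero_le _)
    (Finset.mem_univ j)).trans (Finset.single_le_sum (f := fun i => ∑ j, N i j)
    (fun _ _ => Nat.zero_le _) (Finset.mem_univ i))

/-- The unit group carries the topology induced from g ↦ (g, g⁻¹), so both components need control;
since congruence subgroups are closed under inversion, one exponent serves for both. -/
lemma exists_congruenceSubgroup_le {U : Subgroup (GL (Fin 2) k⸨X⸩)}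
    (hU : IsOpen (U : Set (GL (Fin 2) k⸨X⸩))) : ∃ n, congruenceSubgroup k n ≤ U := by
  have h1 : (U : Set (GL (Fin 2) k⸨X⸩)) ∈ nhds 1 := hU.mem_nhds U.one_mem
  rw [Units.isEmbedding_embedProduct.nhds_eq_comap, Filter.mem_comap] at h1
  obtain ⟨s, hs, hsU⟩ := h1
  rw [map_one, Prod.one_eq_mk, nhds_prod_eq, Filter.mem_prod_iff] at hs
  obtain ⟨s₁, hs₁, s₂, hs₂, hss⟩ := hs
  have hs₂' : MulOpposite.op ⁻¹' s₂ ∈ nhds (1 : Matrix (Fin 2) (Fin 2) k⸨X⸩) :=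
    MulOpposite.continuous_op.continuousAt.preimage_mem_nhds (by simpa using hs₂)
  obtain ⟨n₁, h₁⟩ := exists_fracIdeal_matrix_subset hs₁
  obtain ⟨n₂, h₂⟩ := exists_fracIdeal_matrix_subset hs₂'
  refine ⟨n₁ + n₂, fun g hg => hsU (hss ⟨h₁ _ fun i j => ?_, h₂ _ fun i j => ?_⟩)⟩
  · exact fracIdeal_antitone (by push_cast; omega) (mem_congruenceSubgroup.1 hg i j)
  · exact fracIdeal_antitone (by push_cast; omega)
      (mem_congruenceSubgroup.1 (inv_mem hg) i j)

end Congruence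

/-! ### Generalities on compact induction -/

section CompactInduction

variable {C G V W : Type*} [Field C] [Group G] [AddCommGroup V] [Module C V]
  [AddCommGroup W] [Module C W]

lemma isSimpleOrder_subrepresentation [Nontrivial V] (π : Representation C G V)
    (h : ∀ σ : Subrepresentation π, ∀ v ∈ σ, v ≠ 0 → σ.toSubmodule = ⊤) : π.IsIrreducible where
  exists_pair_ne := by
    refine ⟨⊥, ⊤, fun h => ?_⟩
    have : (⊥ : Submodule C V) = ⊤ := congrArg Subrepresentation.toSubmodule h
    exact bot_ne_top this
  eq_bot_or_eq_top σ := by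
    by_cases hσ : ∃ v ∈ σ, v ≠ 0
    · obtain ⟨v, hv, hv0⟩ := hσ
      exact Or.inr (Subrepresentation.toSubmodule_injective (h σ v hv hv0))
    · push Not at hσ
      refine Or.inl (Subrepresentation.toSubmodule_injective ?_)
      exact (Submodule.eq_bot_iff _).2 hσ

lemma toSubmodule_eq_top_of_isIrreducible {π : Representation C G V} (hπ : π.IsIrreducible)
    (S : Submodule C V) (hS : ∀ g, ∀ v ∈ S, π g v ∈ S) {v : V} (hv : v ∈ S) (hv0 : v ≠ 0) :
    S = ⊤ := by
  have := hπ
  rcases eq_bot_or_eq_top (⟨S, hS⟩ : Subrepresentation π) with h | h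
  · have h' : S = ⊥ := congrArg Subrepresentation.toSubmodule h
    rw [h'] at hv
    exact absurd ((Submodule.mem_bot C).1 hv) hv0
  · exact congrArg Subrepresentation.toSubmodule h

lemma nontrivial_of_isIrreducible {π : Representation C G V} (hπ : π.IsIrreducible) :
    Nontrivial V := by
  have := hπ
  by_contra h
  rw [not_nontrivial_iff_subsingleton] at h
  obtain ⟨σ, τ, hne⟩ := exists_pair_ne (Subrepresentation π)
  exact hne (Subrepresentation.toSubmodule_injective (Subsingleton.elim _ _))

lemma finiteDimensional_of_isIrreducible [Finite G] {π : Representation C G V}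
    (hπ : π.IsIrreducible) : FiniteDimensional C V := by
  have := nontrivial_of_isIrreducible hπ
  obtain ⟨v, hv⟩ := exists_ne (0 : V)
  have h : Submodule.span C (Set.range fun g => π g v) = ⊤ := by
    refine toSubmodule_eq_top_of_isIrreducible hπ _ (fun g w hw => ?_)
      (Submodule.subset_span ⟨1, rfl⟩) (by simpa using hv)
    induction hw using Submodule.span_induction with
    | mem w hw =>
      obtain ⟨h, rfl⟩ := hw
      exact Submodule.subset_span ⟨g * h, by simp⟩
    | zero => simp
    | add x y _ _ hx hy => rw [map_add]; exact add_mem hx hy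
    | smul c x _ hx => rw [map_smul]; exact Submodule.smul_mem _ _ hx
  exact ⟨h ▸ Submodule.fg_span (Set.finite_range _)⟩

/-- The orbit map of a vector fixed by a subgroup `T` descends to the cosets of `T`. -/
lemma exists_orbitMap (π : Representation C G V) (T : Subgroup G) {v : V}
    (hT : ∀ t ∈ T, π t v = v) :
    ∃ φ : G ⧸ T → V, (∀ s : G, φ s = π s v) ∧ ∀ (s : G) (q : G ⧸ T), φ (s • q) = π s (φ q) := by
  have hwd : ∀ a b : G, QuotientGroup.leftRel T a b → π a v = π b v := by
    intro a b hab
    rw [QuotientGroup.leftRel_apply] at hab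
    have h := hT _ hab
    rw [map_mul, Module.End.mul_apply] at h
    calc π a v = π a (π a⁻¹ (π b v)) := by rw [h]
      _ = π b v := by
        rw [← Module.End.mul_apply, ← map_mul, mul_inv_cancel, map_one, Module.End.one_apply]
  refine ⟨Quotient.lift (fun s => π s v) hwd, fun s => rfl, fun s q => ?_⟩
  induction q using Quotient.inductionOn with
  | h a =>
    change π (s * a) v = π s (π a v)
    rw [map_mul, Module.End.mul_apply]

variable [TopologicalSpace G] [IsTopologicalGroup G] {H : Subgroup G} {ρ : Representation C H W}

lemma cInd_apply (x g : G) (f : cIndSpace H ρ) : (cInd H ρ x f).1 g = f.1 (g * x) := rfl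

lemma cInd_left_mul (f : cIndSpace H ρ) (h : H) (g : G) : f.1 (h * g) = ρ h (f.1 g) := f.2.1 h g

lemma isSmooth_cInd : IsSmooth (cInd H ρ) := by
  intro f
  obtain ⟨-, ⟨U, hU, hf⟩, -⟩ := f.2
  let S : Subgroup G :=
    { carrier := {g | cInd H ρ g f = f}
      mul_mem' := fun {a b} ha hb => by
        simp only [Set.mem_ofPred_eq] at ha hb ⊢
        rw [map_mul, Module.End.mul_apply, hb, ha]
      one_mem' := by simp
      inv_mem' := fun {a} ha => by
        simp only [Set.mem_ofPred_eq] at ha ⊢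
        conv_lhs => rw [← ha]
        rw [← Module.End.mul_apply, ← map_mul, inv_mul_cancel, map_one, Module.End.one_apply] }
  have hUS : U ≤ S := fun u hu => Subtype.ext (funext fun g => hf u hu g)
  exact Subgroup.isOpen_mono hUS hU

open Classical in
/-- The element of `c-Ind_H^G ρ` supported on `H` with a given value at `1`. -/
noncomputable def cIndSingle (H : Subgroup G) (ρ : Representation C H W) (U : Subgroup G)
    (hU : IsOpen (U : Set G)) (hUH : U ≤ H) (hρ : ∀ u (hu : u ∈ U), ρ ⟨u, hUH hu⟩ = 1) :
    W →ₗ[C] cIndSpace H ρ where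
  toFun w := ⟨fun g => if hg : g ∈ H then ρ ⟨g, hg⟩ w else 0, by
    refine ⟨fun h g => ?_, ⟨U, hU, fun u hu g => ?_⟩, ⟨{1}, isCompact_singleton, fun g hg => ?_⟩⟩
    · beta_reduce
      by_cases hg : g ∈ H
      · rw [dif_pos hg, dif_pos (H.mul_mem h.2 hg), ← Module.End.mul_apply, ← map_mul]
        rfl
      · rw [dif_neg hg, dif_neg (by rwa [H.mul_mem_cancel_left h.2]), map_zero]
    · beta_reduce
      by_cases hg : g ∈ H
      · rw [dif_pos hg, dif_pos (H.mul_mem hg (hUH hu))]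
        have : (⟨g * u, H.mul_mem hg (hUH hu)⟩ : H) = ⟨g, hg⟩ * ⟨u, hUH hu⟩ := rfl
        rw [this, map_mul, hρ u hu, mul_one]
      · rw [dif_neg hg, dif_neg (by rwa [H.mul_mem_cancel_right (hUH hu)])]
    · refine ⟨g, ?_, 1, rfl, mul_one g⟩
      by_contra hgH
      exact hg (dif_neg hgH)⟩
  map_add' w w' := by
    refine Subtype.ext (funext fun g => ?_)
    by_cases hg : g ∈ H <;> simp [hg]
  map_smul' c w := by
    refine Subtype.ext (funext fun g => ?_)
    by_cases hg : g ∈ H <;> simp [hg]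

/-! ### Functions supported on the inducing subgroup -/

section Single

variable {U : Subgroup G} (hU : IsOpen (U : Set G)) (hUH : U ≤ H)
  (hρ : ∀ u (hu : u ∈ U), ρ ⟨u, hUH hu⟩ = 1)

lemma cIndSingle_apply_mem (w : W) (h : H) : (cIndSingle H ρ U hU hUH hρ w).1 h = ρ h w :=
  dif_pos h.2

lemma cIndSingle_apply_one (w : W) : (cIndSingle H ρ U hU hUH hρ w).1 1 = w := by
  have := cIndSingle_apply_mem hU hUH hρ w 1
  rwa [map_one] at this

lemma cIndSingle_apply_notMem (w : W) {g : G} (hg : g ∉ H) :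
    (cIndSingle H ρ U hU hUH hρ w).1 g = 0 := dif_neg hg

lemma cIndSingle_ne_zero {w : W} (hw : w ≠ 0) : cIndSingle H ρ U hU hUH hρ w ≠ 0 := by
  intro h
  apply hw
  rw [← cIndSingle_apply_one hU hUH hρ w, h]
  rfl

lemma cInd_cIndSingle (h : H) (w : W) :
    cInd H ρ h (cIndSingle H ρ U hU hUH hρ w) = cIndSingle H ρ U hU hUH hρ (ρ h w) := by
  refine Subtype.ext (funext fun g => ?_)
  rw [cInd_apply]
  by_cases hg : g ∈ H
  · have h1 := cIndSingle_apply_mem hU hUH hρ w (⟨g, hg⟩ * h)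
    have h2 := cIndSingle_apply_mem hU hUH hρ (ρ h w) ⟨g, hg⟩
    rw [map_mul, Module.End.mul_apply] at h1
    exact h1.trans h2.symm
  · rw [cIndSingle_apply_notMem _ _ _ _ hg,
      cIndSingle_apply_notMem _ _ _ _ (by rwa [H.mul_mem_cancel_right h.2])]

lemma eq_cIndSingle_of_support_subset (f : cIndSpace H ρ) (hf : ∀ g ∉ H, f.1 g = 0) :
    f = cIndSingle H ρ U hU hUH hρ (f.1 1) := by
  refine Subtype.ext (funext fun g => ?_)
  by_cases hg : g ∈ H
  · rw [cIndSingle_apply_mem hU hUH hρ _ ⟨g, hg⟩, ← cInd_left_mul, mul_one]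
  · rw [hf g hg, cIndSingle_apply_notMem _ _ _ _ hg]

/-- Compactness modulo the open subgroup H puts the support in finitely many cosets Hd; subtracting
the part of `f` on one coset, a translate of a function supported on H, gives an induction on their
number. -/
lemma span_cInd_cIndSingle_eq_top (hH : IsOpen (H : Set G)) :
    Submodule.span C {f | ∃ (g : G) (w : W), f = cInd H ρ g (cIndSingle H ρ U hU hUH hρ w)} = ⊤ := by
  rw [eq_top_iff]
  have key : ∀ (t : Finset G) (f : cIndSpace H ρ),
      (∀ g, f.1 g ≠ 0 → ∃ d ∈ t, g * d⁻¹ ∈ H) →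
      f ∈ Submodule.span C
        {f | ∃ (g : G) (w : W), f = cInd H ρ g (cIndSingle H ρ U hU hUH hρ w)} := by
    classical
    intro t
    induction t using Finset.induction_on with
    | empty =>
      intro f hf
      have : f = 0 := by
        refine Subtype.ext (funext fun g => ?_)
        by_contra hg
        simpa using hf g hg
      rw [this]
      exact Submodule.zero_mem _
    | insert d t _ ih =>
      intro f hf
      have hmem : cInd H ρ d⁻¹ (cIndSingle H ρ U hU hUH hρ (f.1 d)) ∈ Submodule.span C
          {f | ∃ (g : G) (w : W), f = cInd H ρ g (cIndSingle H ρ U hU hUH hρ w)} :=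
        Submodule.subset_span ⟨_, _, rfl⟩
      rw [← Submodule.sub_mem_iff_left _ hmem]
      refine ih _ fun g hg => ?_
      have hval : (f - cInd H ρ d⁻¹ (cIndSingle H ρ U hU hUH hρ (f.1 d))).1 g =
          f.1 g - (cIndSingle H ρ U hU hUH hρ (f.1 d)).1 (g * d⁻¹) := rfl
      rw [hval] at hg
      by_cases hgd : g * d⁻¹ ∈ H
      · rw [cIndSingle_apply_mem hU hUH hρ _ ⟨_, hgd⟩, ← cInd_left_mul] at hg
        simp at hg
      · rw [cIndSingle_apply_notMem _ _ _ _ hgd, sub_zero] at hg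
        obtain ⟨d', hd', h⟩ := hf g hg
        rcases Finset.mem_insert.1 hd' with rfl | h'
        · exact absurd h hgd
        · exact ⟨d', h', h⟩
  rintro f -
  obtain ⟨-, -, D, hD, hfD⟩ := f.2
  obtain ⟨t, -, ht⟩ := hD.elim_nhds_subcover (fun d => {g | g * d⁻¹ ∈ H}) fun d _ => by
    have hc : Continuous fun g : G => g * d⁻¹ := by fun_prop
    exact (hH.preimage hc).mem_nhds (by simp [H.one_mem])
  refine key t f fun g hg => ?_
  obtain ⟨h, hh, y, hy, rfl⟩ := hfD hg
  obtain ⟨d, hd, hyd⟩ := Set.mem_iUnion₂.1 (ht hy)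
  exact ⟨d, hd, by simpa only [mul_assoc] using H.mul_mem hh hyd⟩

end Single

end CompactInduction

/-! ### Finiteness of the truncated groups -/

instance finite_truncRing (k : Type*) [Field k] [Finite k] (m : ℕ) : Finite (TruncRing k m) := by
  refine Finite.of_surjective (fun c : Fin (m + 1) → k =>
    (Ideal.Quotient.mk _ (PowerSeries.mk fun i => if h : i < m + 1 then c ⟨i, h⟩ else 0) :
      TruncRing k m)) fun x => ?_
  obtain ⟨y, rfl⟩ := Ideal.Quotient.mk_surjective x
  refine ⟨fun i => PowerSeries.coeff i y, ?_⟩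
  rw [Ideal.Quotient.eq, Ideal.mem_span_singleton, PowerSeries.X_pow_dvd_iff]
  intro i hi
  simp [Nat.lt_succ_iff.1 hi]

instance finite_finiteLevel (k : Type*) [Field k] [Finite k] (m : ℕ) : Finite (FiniteLevel k m) :=
  inferInstanceAs (Finite (Matrix (Fin 2) (Fin 2) (TruncRing k m))ˣ)

/-- Any entrywise lift is invertible: its determinant is a unit modulo t^(m+1), hence has nonzero
constant term. -/
lemma reduction_surjective {k : Type*} [Field k] (m : ℕ) :
    Function.Surjective (reduction k m) := by
  intro g
  choose A hA using fun i j => Ideal.Quotient.mk_surjective (g.1 i j)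
  have hdet : Ideal.Quotient.mk _ (Matrix.of A).det = g.1.det := by
    rw [RingHom.map_det]
    congr 1
    exact Matrix.ext fun i j => hA i j
  have hunit : IsUnit (Matrix.of A).det := by
    obtain ⟨y, hy⟩ := Ideal.Quotient.mk_surjective (g.det⁻¹ : (TruncRing k m)ˣ).1
    have h1 : Ideal.Quotient.mk (Ideal.span {(PowerSeries.X : k⟦X⟧) ^ (m + 1)})
        ((Matrix.of A).det * y) = Ideal.Quotient.mk _ 1 := by
      rw [map_mul, hdet, hy, map_one]
      exact g.det.mul_inv
    rw [Ideal.Quotient.eq, Ideal.mem_span_singleton] at h1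
    have h2 := PowerSeries.X_dvd_iff.1 ((dvd_pow_self _ m.succ_ne_zero).trans h1)
    rw [map_sub, map_mul, map_one, sub_eq_zero] at h2
    rw [PowerSeries.isUnit_iff_constantCoeff]
    exact IsUnit.of_mul_eq_one _ h2
  exact ⟨Matrix.GeneralLinearGroup.mk'' (Matrix.of A) hunit,
    Units.ext (Matrix.ext fun i j => hA i j)⟩

/-! ### Vanishing of invariant functions, and irreducibility -/

section Main

variable {k C W : Type*} [Field k] [Field C] [AddCommGroup W] [Module C W] {m : ℕ}
  {ξ : Representation C (FiniteLevel k m) W} {Ξ : Representation C (ZK k) W}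

lemma reduction_upperRightHom (m : ℕ) (y : k⟦X⟧) :
    reduction k m (upperRightHom y) = upperRightHom (Ideal.Quotient.mk _ y) := by
  refine Units.ext (Matrix.ext fun i j => ?_)
  change Ideal.Quotient.mk _ ((upperRightHom y).1 i j) = _
  fin_cases i <;> fin_cases j <;> simp

lemma eq_zero_of_forall_upperRightHom
    (hN : ¬ ContainsCharOn ξ (unipFiltration k m m) (fun _ => 1)) {w : W}
    (hw : ∀ y : k⟦X⟧, ξ (reduction k m (upperRightHom (PowerSeries.X ^ m * y))) w = w) : w = 0 := by
  by_contra hw0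
  refine hN ⟨w, hw0, ?_⟩
  rintro _ ⟨u, hu, rfl⟩
  obtain ⟨v, rfl⟩ := Ideal.mem_span_singleton.1 hu
  obtain ⟨y, rfl⟩ := Ideal.Quotient.mk_surjective v
  have h := hw y
  rw [reduction_upperRightHom, map_mul, map_pow] at h
  rw [h, one_smul]

lemma cInd_toGL_mul (hΞ : ∀ g : GL (Fin 2) k⟦X⟧, Ξ (toZK k g) = ξ (reduction k m g))
    (f : cIndSpace (ZK k) Ξ) (κ : GL (Fin 2) k⟦X⟧) (g : GL (Fin 2) k⸨X⸩) :
    f.1 (toGL k κ * g) = ξ (reduction k m κ) (f.1 g) := by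
  rw [← hΞ, ← cInd_left_mul, coe_toZK]

lemma cInd_eq_zero_of_forall_upperRightHom
    (hN : ¬ ContainsCharOn ξ (unipFiltration k m m) (fun _ => 1))
    (hΞ : ∀ g : GL (Fin 2) k⟦X⟧, Ξ (toZK k g) = ξ (reduction k m g))
    (f : cIndSpace (ZK k) Ξ) (g : GL (Fin 2) k⸨X⸩)
    (hf : ∀ y : k⟦X⟧, f.1 (toGL k (upperRightHom (PowerSeries.X ^ m * y)) * g) = f.1 g) :
    f.1 g = 0 :=
  eq_zero_of_forall_upperRightHom hN fun y => by rw [← cInd_toGL_mul hΞ, hf]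

lemma toGL_upperRightHom_mul_diagPow (y : k⟦X⟧) (j : ℕ) :
    toGL k (upperRightHom y) * diagPow k j =
      diagPow k j * toGL k (upperRightHom (y * PowerSeries.X ^ j)) := by
  have h : (ιO (y * PowerSeries.X ^ j) : k⸨X⸩) = ιO y * unif k ^ j := by
    rw [map_mul, algebraMap_X_pow, zpow_natCast]
  rw [toGL_upperRightHom, toGL_upperRightHom, upperRightHom_mul_diagPow, h]

/-- N^m passes through diag(1, t^j) into N^(m+j), which lies in the normal subgroup of K of matrices
congruent to 1 modulo t^(n+1). So it can also be moved past κ and absorbed by the invariance of `f`.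
-/
lemma cInd_diagPow_eq_zero
    (hN : ¬ ContainsCharOn ξ (unipFiltration k m m) (fun _ => 1))
    (hΞ : ∀ g : GL (Fin 2) k⟦X⟧, Ξ (toZK k g) = ξ (reduction k m g))
    {n : ℕ} {f : cIndSpace (ZK k) Ξ}
    (hf : f ∈ fixedVectors (cInd (ZK k) Ξ) (congruenceSubgroup k n))
    {j : ℕ} (hj : n + 1 ≤ m + j) (κ : GL (Fin 2) k⟦X⟧) :
    f.1 (diagPow k j * toGL k κ) = 0 := by
  refine cInd_eq_zero_of_forall_upperRightHom hN hΞ f _ fun y => ?_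
  rw [← mul_assoc, toGL_upperRightHom_mul_diagPow]
  obtain ⟨μ, hμd⟩ : ∃ μ : GL (Fin 2) k⟦X⟧,
    μ = upperRightHom (PowerSeries.X ^ m * y * PowerSeries.X ^ j) := ⟨_, rfl⟩
  have hμ : μ ∈ (reduction k n).ker := by
    rw [hμd, MonoidHom.mem_ker, reduction_upperRightHom]
    have : (Ideal.Quotient.mk _ (PowerSeries.X ^ m * y * PowerSeries.X ^ j) : TruncRing k n) = 0 := by
      rw [Ideal.Quotient.eq_zero_iff_mem, Ideal.mem_span_singleton]
      refine (pow_dvd_pow _ hj).trans ⟨y, by ring⟩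
    rw [this, AddChar.map_zero_eq_one]
  have h1 : toGL k (κ⁻¹ * μ * κ) ∈ congruenceSubgroup k n :=
    ⟨_, by simpa using (MonoidHom.normal_ker (reduction k n)).conj_mem μ hμ κ⁻¹, rfl⟩
  have h2 := congrFun (congrArg Subtype.val (hf _ h1)) (diagPow k j * toGL k κ)
  rw [cInd_apply] at h2
  have h3 : diagPow k j * toGL k μ * toGL k κ =
      diagPow k j * toGL k κ * toGL k (κ⁻¹ * μ * κ) := by
    rw [map_mul, map_mul, map_inv]
    group
  rw [← hμd, h3, h2]

lemma cInd_eq_zero_of_notMem_ZK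
    (hN : ¬ ContainsCharOn ξ (unipFiltration k m m) (fun _ => 1))
    (hΞ : ∀ g : GL (Fin 2) k⟦X⟧, Ξ (toZK k g) = ξ (reduction k m g))
    {f : cIndSpace (ZK k) Ξ}
    (hf : f ∈ fixedVectors (cInd (ZK k) Ξ) (congruenceSubgroup k m))
    {g : GL (Fin 2) k⸨X⸩} (hg : g ∉ ZK k) : f.1 g = 0 := by
  obtain ⟨ζ, hζ, j, κ, rfl⟩ := exists_cartan g
  rcases Nat.eq_zero_or_pos j with rfl | hj
  · rw [diagPow_zero, mul_one] at hg
    exact absurd ((ZK k).mul_mem hζ (toGL_mem_ZK κ)) hg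
  · rw [mul_assoc, cInd_left_mul f ⟨ζ, hζ⟩, cInd_diagPow_eq_zero hN hΞ hf (by omega), map_zero]

lemma apply_eq_one_of_mem_congruenceSubgroup
    (hΞ : ∀ g : GL (Fin 2) k⟦X⟧, Ξ (toZK k g) = ξ (reduction k m g))
    (u : GL (Fin 2) k⸨X⸩) (hu : u ∈ congruenceSubgroup k m) :
    Ξ ⟨u, congruenceSubgroup_le_ZK m hu⟩ = 1 := by
  obtain ⟨κ, hκ, rfl⟩ := hu
  rw [← map_one ξ, ← show reduction k m κ = 1 from hκ, ← hΞ]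
  rfl

/-- The function in `c-Ind Ξ` supported on `ZK` with a given value at `1`. -/
noncomputable def single
    (hΞ : ∀ g : GL (Fin 2) k⟦X⟧, Ξ (toZK k g) = ξ (reduction k m g)) :
    W →ₗ[C] cIndSpace (ZK k) Ξ :=
  cIndSingle (ZK k) Ξ (congruenceSubgroup k m) (isOpen_congruenceSubgroup m)
    (congruenceSubgroup_le_ZK m) (apply_eq_one_of_mem_congruenceSubgroup hΞ)

lemma single_ne_zero (hΞ : ∀ g : GL (Fin 2) k⟦X⟧, Ξ (toZK k g) = ξ (reduction k m g))
    {w : W} (hw : w ≠ 0) : single hΞ w ≠ 0 := cIndSingle_ne_zero _ _ _ hw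

lemma cInd_toGL_single (hΞ : ∀ g : GL (Fin 2) k⟦X⟧, Ξ (toZK k g) = ξ (reduction k m g))
    (κ : GL (Fin 2) k⟦X⟧) (w : W) :
    cInd (ZK k) Ξ (toGL k κ) (single hΞ w) = single hΞ (ξ (reduction k m κ) w) := by
  rw [← hΞ, ← coe_toZK]
  exact cInd_cIndSingle _ _ _ _ _

lemma span_cInd_single_eq_top
    (hΞ : ∀ g : GL (Fin 2) k⟦X⟧, Ξ (toZK k g) = ξ (reduction k m g)) :
    Submodule.span C {f | ∃ (g : GL (Fin 2) k⸨X⸩) (w : W),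
      f = cInd (ZK k) Ξ g (single hΞ w)} = ⊤ :=
  span_cInd_cIndSingle_eq_top _ _ _ isOpen_ZK

lemma exists_fixed_congruenceSubgroup (f : cIndSpace (ZK k) Ξ) :
    ∃ n, f ∈ fixedVectors (cInd (ZK k) Ξ) (congruenceSubgroup k n) := by
  obtain ⟨-, ⟨U, hU, hf⟩, -⟩ := f.2
  obtain ⟨n, hn⟩ := exists_congruenceSubgroup_le hU
  exact ⟨n, fun u hu => Subtype.ext (funext fun g => hf u (hn hu) g)⟩

section Irreducible

variable [Finite k] [CharZero C]

/-- The sum runs over the orbit of `f` under S, the congruence subgroup modulo t^(m+1); it is finite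
because T fixes `f` and S/T embeds in K_n. Left equivariance gives f(κ) = f(1) on S, so the value at
1 is multiplied by the index, nonzero in characteristic 0. -/
lemma exists_fixed_mem_subrepresentation
    (hΞ : ∀ g : GL (Fin 2) k⟦X⟧, Ξ (toZK k g) = ξ (reduction k m g))
    (σ : Subrepresentation (cInd (ZK k) Ξ)) (f : cIndSpace (ZK k) Ξ) (hf : f ∈ σ)
    (hf1 : f.1 1 ≠ 0) :
    ∃ f' ∈ σ, f' ∈ fixedVectors (cInd (ZK k) Ξ) (congruenceSubgroup k m) ∧ f'.1 1 ≠ 0 := by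
  obtain ⟨n, hn⟩ := exists_fixed_congruenceSubgroup f
  let S : Subgroup (GL (Fin 2) k⟦X⟧) := (reduction k m).ker
  let π : Representation C S (cIndSpace (ZK k) Ξ) :=
    (cInd (ZK k) Ξ).comp ((toGL k).comp S.subtype)
  let T : Subgroup S := ((reduction k n).comp S.subtype).ker
  have hT : ∀ t ∈ T, π t f = f := fun t ht => hn _ ⟨t.1, ht, rfl⟩
  obtain ⟨φ, hφ, hφs⟩ := exists_orbitMap π T hT
  have : Finite (S ⧸ T) := Finite.of_injective _
    (QuotientGroup.kerLift_injective ((reduction k n).comp S.subtype))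
  have := Fintype.ofFinite (S ⧸ T)
  refine ⟨∑ q, φ q, ?_, ?_, ?_⟩
  · refine Submodule.sum_mem σ.toSubmodule fun q _ => ?_
    induction q using QuotientGroup.induction_on with
    | H s =>
      rw [hφ]
      exact σ.apply_mem_toSubmodule _ hf
  · rintro _ ⟨κ, hκ, rfl⟩
    have h1 : cInd (ZK k) Ξ (toGL k κ) = π ⟨κ, hκ⟩ := rfl
    rw [h1, map_sum]
    simp only [← hφs]
    exact Fintype.sum_equiv (MulAction.toPerm (⟨κ, hκ⟩ : S)) _ _ fun q => rfl
  · have h1 : ∀ q, (φ q).1 1 = f.1 1 := by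
      intro q
      induction q using QuotientGroup.induction_on with
      | H s =>
        rw [hφ]
        change f.1 (1 * toGL k s.1) = _
        have := cInd_toGL_mul hΞ f s.1 1
        rw [mul_one, show reduction k m s.1 = 1 from s.2, map_one, Module.End.one_apply] at this
        rw [one_mul, this]
    have h2 : (∑ q, φ q).1 1 = ∑ q, (φ q).1 1 := by
      rw [AddSubmonoidClass.coe_finsetSum, Finset.sum_apply]
    rw [h2, Finset.sum_congr rfl fun q _ => h1 q, Finset.sum_const, ← Nat.cast_smul_eq_nsmul C]
    exact smul_ne_zero (Nat.cast_ne_zero.2 Fintype.card_ne_zero) hf1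

theorem cInd_isIrreducible (hirr : ξ.IsIrreducible)
    (hN : ¬ ContainsCharOn ξ (unipFiltration k m m) (fun _ => 1))
    (hΞ : ∀ g : GL (Fin 2) k⟦X⟧, Ξ (toZK k g) = ξ (reduction k m g)) :
    (cInd (ZK k) Ξ).IsIrreducible := by
  have hW := nontrivial_of_isIrreducible hirr
  obtain ⟨w₀, hw₀⟩ := exists_ne (0 : W)
  have : Nontrivial (cIndSpace (ZK k) Ξ) := ⟨_, _, single_ne_zero hΞ hw₀⟩
  refine isSimpleOrder_subrepresentation _ fun σ f hf hf0 => ?_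
  obtain ⟨g, hg⟩ : ∃ g, f.1 g ≠ 0 := by
    by_contra h
    push Not at h
    exact hf0 (Subtype.ext (funext h))
  obtain ⟨f', hf', hfix, hf1⟩ := exists_fixed_mem_subrepresentation hΞ σ (cInd (ZK k) Ξ g f)
    (σ.apply_mem_toSubmodule g hf) (by rwa [cInd_apply, one_mul])
  have hf'eq : f' = single hΞ (f'.1 1) :=
    eq_cIndSingle_of_support_subset _ _ _ f' fun g hg => cInd_eq_zero_of_notMem_ZK hN hΞ hfix hg
  -- The invariant vector lies in the copy of `W`; irreducibility of `ξ` then puts the whole copy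
  -- into `σ`, and its translates span.
  have htop : σ.toSubmodule.comap (single hΞ) = ⊤ := by
    refine toSubmodule_eq_top_of_isIrreducible hirr _ (fun g w hw => ?_) (v := f'.1 1) ?_ hf1
    · obtain ⟨κ, rfl⟩ := reduction_surjective m g
      rw [Submodule.mem_comap, ← cInd_toGL_single]
      exact σ.apply_mem_toSubmodule _ hw
    · rw [Submodule.mem_comap, ← hf'eq]
      exact hf'
  rw [eq_top_iff, ← span_cInd_single_eq_top hΞ, Submodule.span_le]
  rintro _ ⟨g, w, rfl⟩
  refine σ.apply_mem_toSubmodule g ?_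
  have : w ∈ σ.toSubmodule.comap (single hΞ) := htop ▸ Submodule.mem_top
  exact this

end Irreducible

end Main

/-! ### Cuspidality and admissibility -/

section CuspidalAdmissible

variable {k C W : Type*} [Field k] [Field C] [AddCommGroup W] [Module C W] {m : ℕ}
  {ξ : Representation C (FiniteLevel k m) W} {Ξ : Representation C (ZK k) W}

/-- The sum is fixed by N_m^m, hence zero. Summing over the whole ring only counts each element of
N_m^m with a constant multiplicity. -/
lemma sum_upperRightHom_eq_zero [Fintype (TruncRing k m)]
    (hN : ¬ ContainsCharOn ξ (unipFiltration k m m) (fun _ => 1)) (w : W) :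
    ∑ y : TruncRing k m,
      ξ (upperRightHom (Ideal.Quotient.mk _ (PowerSeries.X ^ m : k⟦X⟧) * y)) w = 0 := by
  refine eq_zero_of_forall_upperRightHom hN fun z => ?_
  rw [map_sum, reduction_upperRightHom]
  refine Fintype.sum_equiv (Equiv.addLeft (Ideal.Quotient.mk _ z)) _ _ fun y => ?_
  rw [← Module.End.mul_apply, ← map_mul, ← AddChar.map_add_eq_mul, Equiv.coe_addLeft, mul_add,
    map_mul]

lemma upperRightHom_conj_of_lower_eq_zero {F : Type*} [Field F] {b : GL (Fin 2) F}
    (hb : b 1 0 = 0) (x : F) :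
    b * upperRightHom x = upperRightHom (b 0 0 * x / b 1 1) * b := by
  have h11 : b 1 1 ≠ 0 := by
    intro h
    have hdet : b.1.det ≠ 0 := b.det.ne_zero
    rw [Matrix.det_fin_two, h, hb] at hdet
    simp at hdet
  refine Units.ext (Matrix.ext fun i j => ?_)
  fin_cases i <;> fin_cases j <;> simp [Matrix.mul_apply, Fin.sum_univ_two, hb]
  rw [div_mul_cancel₀ _ h11]
  ring

lemma single_mem_span [Finite k] [CharZero C]
    (hN : ¬ ContainsCharOn ξ (unipFiltration k m m) (fun _ => 1))
    (hΞ : ∀ g : GL (Fin 2) k⟦X⟧, Ξ (toZK k g) = ξ (reduction k m g)) (w : W) :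
    single hΞ w ∈ Submodule.span C {f : cIndSpace (ZK k) Ξ | ∃ (x : k⸨X⸩) (v : cIndSpace (ZK k) Ξ),
      f = cInd (ZK k) Ξ (upperRightHom x) v - v} := by
  have := Fintype.ofFinite (TruncRing k m)
  have hcard : (Fintype.card (TruncRing k m) : C) ≠ 0 := Nat.cast_ne_zero.2 Fintype.card_ne_zero
  have h1 : (Fintype.card (TruncRing k m) : C) • single hΞ w = - ∑ y : TruncRing k m,
      (single hΞ (ξ (upperRightHom (Ideal.Quotient.mk _ (PowerSeries.X ^ m : k⟦X⟧) * y)) w) -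
        single hΞ w) := by
    rw [Finset.sum_sub_distrib, ← map_sum, sum_upperRightHom_eq_zero hN, map_zero, zero_sub,
      neg_neg, Finset.sum_const, Nat.cast_smul_eq_nsmul]
    rfl
  rw [← Submodule.smul_mem_iff _ hcard, h1]
  refine Submodule.neg_mem _ (Submodule.sum_mem _ fun y _ => Submodule.subset_span ?_)
  obtain ⟨z, rfl⟩ := Ideal.Quotient.mk_surjective y
  refine ⟨ιO (PowerSeries.X ^ m * z), single hΞ w, ?_⟩
  rw [← toGL_upperRightHom, cInd_toGL_single, reduction_upperRightHom, RingHom.map_mul]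

theorem cInd_isCuspidal [Finite k] [CharZero C] (hirr : ξ.IsIrreducible)
    (hN : ¬ ContainsCharOn ξ (unipFiltration k m m) (fun _ => 1))
    (hΞ : ∀ g : GL (Fin 2) k⟦X⟧, Ξ (toZK k g) = ξ (reduction k m g)) :
    IsCuspidal (cInd (ZK k) Ξ) where
  irreducible := cInd_isIrreducible hirr hN hΞ
  smooth := isSmooth_cInd
  jacquet := by
    rw [eq_top_iff, ← span_cInd_single_eq_top hΞ, Submodule.span_le]
    rintro _ ⟨g, w, rfl⟩
    -- Since K preserves the copy of `W`, g may be replaced by an upper triangular matrix; this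
    -- normalizes N and so preserves V(N).
    obtain ⟨κ, hκ⟩ := exists_upperTriangular g
    have h1 : cInd (ZK k) Ξ g (single hΞ w) =
        cInd (ZK k) Ξ (g * toGL k κ) (single hΞ (ξ (reduction k m κ⁻¹) w)) := by
      rw [← cInd_toGL_single, ← Module.End.mul_apply, ← map_mul, map_inv, mul_inv_cancel_right]
    rw [h1]
    generalize ξ (reduction k m κ⁻¹) w = w'
    have h2 := single_mem_span hN hΞ w'
    rw [SetLike.mem_coe]
    generalize single hΞ w' = v₀ at h2 ⊢
    induction h2 using Submodule.span_induction with
    | mem v hv =>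
      obtain ⟨x, v, rfl⟩ := hv
      refine Submodule.subset_span ⟨(g * toGL k κ).1 0 0 * x / (g * toGL k κ).1 1 1,
        cInd (ZK k) Ξ (g * toGL k κ) v, ?_⟩
      rw [map_sub, ← Module.End.mul_apply, ← map_mul, upperRightHom_conj_of_lower_eq_zero hκ,
        map_mul, Module.End.mul_apply]
    | zero => rw [map_zero]; exact Submodule.zero_mem _
    | add x y _ _ hx hy => rw [map_add]; exact add_mem hx hy
    | smul c x _ hx => rw [map_smul]; exact Submodule.smul_mem _ _ hx

lemma finiteDimensional_of_linearMap_eq_zero {V V' : Type*} [AddCommGroup V] [Module C V]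
    [AddCommGroup V'] [Module C V'] [FiniteDimensional C V'] (S : Submodule C V) (Φ : V →ₗ[C] V')
    (h : ∀ v ∈ S, Φ v = 0 → v = 0) : FiniteDimensional C S := by
  refine Module.Finite.of_injective (Φ.domRestrict S) ?_
  rw [← LinearMap.ker_eq_bot, LinearMap.ker_eq_bot']
  exact fun v hv => Subtype.ext (h v v.2 hv)

theorem cInd_isAdmissible [Finite k] (hirr : ξ.IsIrreducible)
    (hN : ¬ ContainsCharOn ξ (unipFiltration k m m) (fun _ => 1))
    (hΞ : ∀ g : GL (Fin 2) k⟦X⟧, Ξ (toZK k g) = ξ (reduction k m g)) :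
    IsAdmissible (cInd (ZK k) Ξ) where
  smooth := isSmooth_cInd
  finite H hH _ := by
    have := finiteDimensional_of_isIrreducible hirr
    obtain ⟨n, hn⟩ := exists_congruenceSubgroup_le hH
    choose lift hlift using reduction_surjective (k := k) n
    -- Evaluation at diag(1, t^j)κ for j ≤ n and representatives κ modulo t^(n+1). It is injective
    -- on the invariants, since these vanish for larger j.
    let Φ : cIndSpace (ZK k) Ξ →ₗ[C] (Fin (n + 1) × FiniteLevel k n → W) :=
      { toFun := fun f p => f.1 (diagPow k p.1 * toGL k (lift p.2))
        map_add' := fun _ _ => rfl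
        map_smul' := fun _ _ => rfl }
    refine finiteDimensional_of_linearMap_eq_zero _ Φ fun f hfH hf => ?_
    have hfix : f ∈ fixedVectors (cInd (ZK k) Ξ) (congruenceSubgroup k n) :=
      fun u hu => hfH u (hn hu)
    refine Subtype.ext (funext fun g => ?_)
    change f.1 g = 0
    obtain ⟨ζ, hζ, j, κ, rfl⟩ := exists_cartan g
    rw [mul_assoc, cInd_left_mul f ⟨ζ, hζ⟩]
    suffices h : f.1 (diagPow k j * toGL k κ) = 0 by rw [h, map_zero]
    rcases lt_or_ge j (n + 1) with hj | hj
    · have h1 := congrFun hf (⟨j, hj⟩, reduction k n κ)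
      change f.1 (diagPow k j * toGL k (lift (reduction k n κ))) = 0 at h1
      have hmem : toGL k ((lift (reduction k n κ))⁻¹ * κ) ∈ congruenceSubgroup k n :=
        ⟨_, by
          change reduction k n _ = 1
          rw [map_mul, map_inv, hlift, inv_mul_cancel], rfl⟩
      have h2 := congrFun (congrArg Subtype.val (hfix _ hmem))
        (diagPow k j * toGL k (lift (reduction k n κ)))
      rw [cInd_apply, h1, mul_assoc, ← map_mul, mul_inv_cancel_left] at h2
      exact h2
    · exact cInd_diagPow_eq_zero hN hΞ hfix (by omega) κ

end CuspidalAdmissible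

/-! ### Lattice chains -/

section Chains

variable {k : Type*} [Field k]

lemma mem_stdChain_L {i : ℤ} {v : Fin 2 → k⸨X⸩} :
    v ∈ (stdChain k).L i ↔ ∀ j, v j ∈ fracIdeal k i := by
  constructor
  · rintro ⟨w, rfl⟩ j
    exact ⟨w j, rfl⟩
  · intro h
    choose w hw using h
    exact ⟨w, (funext hw).symm⟩

lemma mem_stdChain_radPow {n : ℤ} {x : Matrix (Fin 2) (Fin 2) k⸨X⸩} :
    x ∈ (stdChain k).radPow n ↔ ∀ i j, x i j ∈ fracIdeal k n := by
  constructor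
  · intro h i j
    have h1 : (Pi.single j 1 : Fin 2 → k⸨X⸩) ∈ (stdChain k).L 0 := by
      rw [mem_stdChain_L]
      intro l
      by_cases hl : l = j
      · subst hl
        exact ⟨1, by simp⟩
      · rw [Pi.single_eq_of_ne hl]
        exact Submodule.zero_mem _
    have h2 := mem_stdChain_L.1 (h 0 _ h1) i
    rwa [zero_add, Matrix.mulVec_single_one] at h2
  · intro h i v hv
    rw [mem_stdChain_L] at hv ⊢
    intro j
    rw [Matrix.mulVec, dotProduct, add_comm]
    exact Submodule.sum_mem _ fun l _ => mul_mem_fracIdeal (h j l) (hv l)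

lemma mem_stdChain_unitGroup {n : ℕ} {g : GL (Fin 2) k⸨X⸩} :
    g ∈ (stdChain k).unitGroup n ↔ ∀ i j, (g.1 - 1) i j ∈ fracIdeal k n := mem_stdChain_radPow

lemma mem_stdChain_unitGroup_succ {n : ℕ} {g : GL (Fin 2) k⸨X⸩} :
    g ∈ (stdChain k).unitGroup (n + 1) ↔ g ∈ congruenceSubgroup k n := by
  rw [mem_stdChain_unitGroup, mem_congruenceSubgroup]

variable (Λ : LatticeChain k)

lemma LatticeChain.unif_smul_mem_iff {i : ℤ} {v : Fin 2 → k⸨X⸩} :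
    unif k • v ∈ Λ.L (i + Λ.e) ↔ v ∈ Λ.L i := by
  have hX : ∀ w : Fin 2 → k⸨X⸩, (PowerSeries.X : k⟦X⟧) • w = unif k • w := fun w =>
    (algebraMap_smul k⸨X⸩ (PowerSeries.X : k⟦X⟧) w).symm
  rw [← Λ.period, Submodule.mem_smul_pointwise_iff_exists]
  constructor
  · rintro ⟨w, hw, h⟩
    rw [hX] at h
    rwa [← smul_right_injective _ (unif_ne_zero k) h]
  · exact fun h => ⟨v, h, hX v⟩

lemma LatticeChain.unif_zpow_smul_mem_iff {i : ℤ} {v : Fin 2 → k⸨X⸩} (d : ℤ) :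
    unif k ^ d • v ∈ Λ.L (i + d * Λ.e) ↔ v ∈ Λ.L i := by
  induction d with
  | zero => simp
  | succ d ih =>
    have h1 : unif k ^ (d + 1 : ℤ) • v = unif k • unif k ^ (d : ℤ) • v := by
      rw [smul_smul, ← zpow_one_add₀ (unif_ne_zero k), add_comm]
    have h2 : i + (d + 1 : ℤ) * Λ.e = i + d * Λ.e + Λ.e := by ring
    rw [h1, h2, Λ.unif_smul_mem_iff, ih]
  | pred d ih =>
    have h1 : unif k ^ (-d : ℤ) • v = unif k • unif k ^ (-d - 1 : ℤ) • v := by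
      rw [smul_smul, ← zpow_one_add₀ (unif_ne_zero k), add_sub_cancel]
    have h2 : i + (-d : ℤ) * Λ.e = i + (-d - 1) * Λ.e + Λ.e := by ring
    rw [← ih, h1, h2, Λ.unif_smul_mem_iff]

/-- Period 0 would give tL₀ = L₀, hence L₀ = 0 by Nakayama. -/
lemma LatticeChain.e_pos : 0 < Λ.e := by
  rw [Nat.pos_iff_ne_zero]
  intro he
  have hp := Λ.period 0
  rw [he, Nat.cast_zero, add_zero] at hp
  have hbot : Λ.L 0 = ⊥ := by
    refine Submodule.eq_bot_of_le_smul_of_le_jacobson_bot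
      (Ideal.span {(PowerSeries.X : k⟦X⟧)}) _ (Λ.isLattice 0).fg ?_ ?_
    · rw [Submodule.ideal_span_singleton_smul, hp]
    · rw [IsLocalRing.jacobson_eq_maximalIdeal _ bot_ne_top, PowerSeries.maximalIdeal_eq_span_X]
  have := (Λ.isLattice 0).span_eq_top
  rw [hbot] at this
  simp at this

lemma LatticeChain.exists_mulVec_mem_fracIdeal (g : GL (Fin 2) k⸨X⸩) (i : ℤ) :
    ∃ N : ℤ, ∀ v ∈ Λ.L i, ∀ j, g.1.mulVec v j ∈ fracIdeal k N := by
  obtain ⟨s, hs⟩ := (Λ.isLattice i).fg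
  choose N hN using fun (v : Fin 2 → k⸨X⸩) (j : Fin 2) => exists_mem_fracIdeal (g.1.mulVec v j)
  refine ⟨-∑ v ∈ s, ∑ j, |N v j|, fun v hv j => ?_⟩
  rw [← hs] at hv
  induction hv using Submodule.span_induction with
  | mem w hw =>
    refine fracIdeal_antitone ?_ (hN w j)
    have h1 : |N w j| ≤ ∑ j, |N w j| :=
      Finset.single_le_sum (f := fun j => |N w j|) (fun _ _ => abs_nonneg _) (Finset.mem_univ j)
    have h2 : ∑ j, |N w j| ≤ ∑ v ∈ s, ∑ j, |N v j| :=
      Finset.single_le_sum (f := fun v => ∑ j, |N v j|)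
        (fun _ _ => Finset.sum_nonneg fun _ _ => abs_nonneg _) hw
    have h3 := neg_abs_le (N w j)
    omega
  | zero => rw [Matrix.mulVec_zero]; exact Submodule.zero_mem _
  | add x y _ _ hx hy => rw [Matrix.mulVec_add]; exact Submodule.add_mem _ hx hy
  | smul c x _ hx =>
    rw [Matrix.mulVec_smul]
    exact Submodule.smul_mem _ _ hx

/-- The last term of a lattice chain that `g` does not carry into `t O_F²`. -/
lemma LatticeChain.exists_last_not_le (g : GL (Fin 2) k⸨X⸩) :
    ∃ i : ℤ, (∃ v ∈ Λ.L i, ∃ j, g.1.mulVec v j ∉ fracIdeal k 1) ∧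
      ∀ i', i < i' → ∀ v ∈ Λ.L i', ∀ j, g.1.mulVec v j ∈ fracIdeal k 1 := by
  have he : (0 : ℤ) < Λ.e := by exact_mod_cast Λ.e_pos
  obtain ⟨i, hi, hmax⟩ := Int.exists_greatest_of_bdd
    (P := fun i => ∃ v ∈ Λ.L i, ∃ j, g.1.mulVec v j ∉ fracIdeal k 1) (by
      obtain ⟨N, hN⟩ := Λ.exists_mulVec_mem_fracIdeal g 0
      -- As g carries L₀ into t^N O_F², it carries t^(1-N)L₀, of index (1 - N)e, into tO_F².
      refine ⟨(1 - N) * Λ.e, ?_⟩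
      rintro i ⟨v, hv, j, hj⟩
      by_contra hlt
      push Not at hlt
      apply hj
      have h1 : unif k ^ (-(1 - N)) • v ∈ Λ.L 0 := by
        rw [← Λ.unif_zpow_smul_mem_iff (1 - N), smul_smul, ← zpow_add₀ (unif_ne_zero k),
          add_neg_cancel, zpow_zero, one_smul, zero_add]
        exact Λ.strictAnti.antitone hlt.le hv
      have h2 := hN _ h1 j
      rw [Matrix.mulVec_smul, Pi.smul_apply, smul_eq_mul, unif_zpow_mul_mem_fracIdeal] at h2
      convert h2 using 2
      ring) (by
      obtain ⟨v, hv, hv0⟩ : ∃ v ∈ Λ.L 0, v ≠ 0 := by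
        by_contra h
        push Not at h
        have hbot : Λ.L 0 = ⊥ := (Submodule.eq_bot_iff _).2 h
        have := (Λ.isLattice 0).span_eq_top
        rw [hbot] at this
        simp at this
      have hgv : g.1.mulVec v ≠ 0 := by
        intro h
        have h1 := congrArg (g⁻¹.1.mulVec) h
        rw [Matrix.mulVec_mulVec, ← Units.val_mul, inv_mul_cancel, Units.val_one,
          Matrix.one_mulVec, Matrix.mulVec_zero] at h1
        exact hv0 h1
      obtain ⟨j, hj⟩ := Function.ne_iff.1 hgv
      obtain ⟨n, hn⟩ := exists_notMem_fracIdeal hj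
      refine ⟨0 + (1 - n) * Λ.e, unif k ^ (1 - n) • v, (Λ.unif_zpow_smul_mem_iff _).2 hv, j, ?_⟩
      rw [Matrix.mulVec_smul, Pi.smul_apply, smul_eq_mul, unif_zpow_mul_mem_fracIdeal]
      convert hn using 2
      ring_nf)
  refine ⟨i, hi, fun i' hi' v hv j => ?_⟩
  by_contra h
  exact absurd (hmax i' ⟨v, hv, j, h⟩) (not_le.2 hi')

/-- A primitive vector is the first column of a matrix in SL₂(O_F). Determinant one matters: it
makes κE₁₂κ⁻¹ a function of the first column alone, as computed in the next lemma. -/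
lemma exists_GL_first_column (ε : Fin 2 → k⟦X⟧) {j : Fin 2}
    (hj : PowerSeries.constantCoeff (ε j) ≠ 0) :
    ∃ κ : GL (Fin 2) k⟦X⟧, κ.1.det = 1 ∧ κ 0 0 = ε 0 ∧ κ 1 0 = ε 1 := by
  have hu : IsUnit (ε j) := PowerSeries.isUnit_iff_constantCoeff.2 hj.isUnit
  obtain ⟨u, hu⟩ := hu
  obtain ⟨A, hA, h0, h1⟩ : ∃ A : Matrix (Fin 2) (Fin 2) k⟦X⟧, A.det = 1 ∧ A 0 0 = ε 0 ∧
      A 1 0 = ε 1 := by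
    fin_cases j
    · exact ⟨!![ε 0, 0; ε 1, (u⁻¹ : k⟦X⟧ˣ)], by
        rw [Matrix.det_fin_two_of, ← show (u : k⟦X⟧) = ε 0 from hu]; simp, rfl, rfl⟩
    · exact ⟨!![ε 0, -(u⁻¹ : k⟦X⟧ˣ); ε 1, 0], by
        rw [Matrix.det_fin_two_of, ← show (u : k⟦X⟧) = ε 1 from hu]; simp, rfl, rfl⟩
  exact ⟨Matrix.GeneralLinearGroup.mk'' A (by rw [hA]; exact isUnit_one), hA, h0, h1⟩

lemma conj_upperRightHom_of_det_eq_one {R : Type*} [CommRing R] (κ : GL (Fin 2) R)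
    (hκ : κ.1.det = 1) (x : R) :
    (κ * upperRightHom x * κ⁻¹).1 = 1 + x • !![-(κ 0 0 * κ 1 0), κ 0 0 ^ 2;
      -(κ 1 0 ^ 2), κ 0 0 * κ 1 0] := by
  rw [Matrix.det_fin_two] at hκ
  have h : (κ * upperRightHom x).1 = (1 + x • !![-(κ 0 0 * κ 1 0), κ 0 0 ^ 2;
      -(κ 1 0 ^ 2), κ 0 0 * κ 1 0]) * κ.1 := by
    refine Matrix.ext fun i j => ?_
    fin_cases i <;> fin_cases j <;> simp [Matrix.mul_apply, Fin.sum_univ_two]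
    · ring
    · linear_combination (-x * κ 0 0) * hκ
    · ring
    · linear_combination (-x * κ 1 0) * hκ
  rw [Units.val_mul, h, mul_assoc, ← Units.val_mul, mul_inv_cancel, Units.val_one, mul_one]

/-- Every lattice chain order contains, up to an element of `GL₂(O_F)`, the standard nilpotent
matrix; hence its unit groups contain conjugates of the groups `N^m`. -/
lemma LatticeChain.exists_conj_mem_unitGroup (g : GL (Fin 2) k⸨X⸩) :
    ∃ κ : GL (Fin 2) k⟦X⟧, ∀ (m n : ℕ), n ≤ m * Λ.e → ∀ y : k⟦X⟧,
      g⁻¹ * toGL k (κ * upperRightHom (PowerSeries.X ^ m * y) * κ⁻¹) * g ∈ Λ.unitGroup n := by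
  obtain ⟨i₀, ⟨v₀, hv₀, j₀, hj₀⟩, hlast⟩ := Λ.exists_last_not_le g
  have he : (0 : ℤ) < Λ.e := by exact_mod_cast Λ.e_pos
  -- Here tL_i = L_(i+e) lies beyond i₀, so g carries it into tO_F²; divide by t.
  have hint : ∀ i, i₀ < i + Λ.e → ∀ v ∈ Λ.L i, ∀ j, g.1.mulVec v j ∈ fracIdeal k 0 := by
    intro i hi v hv j
    have h1 := hlast _ hi _ (Λ.unif_smul_mem_iff.2 hv) j
    rw [Matrix.mulVec_smul, Pi.smul_apply, smul_eq_mul] at h1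
    have h2 := unif_zpow_mul_mem_fracIdeal (k := k) (a := 1) (b := 1) (x := g.1.mulVec v j)
    rw [zpow_one, sub_self] at h2
    exact h2.1 h1
  choose ε hε using fun j => mem_fracIdeal_zero.1 (hint i₀ (by omega) v₀ hv₀ j)
  rw [hε, algebraMap_mem_fracIdeal_one] at hj₀
  obtain ⟨κ, hdet, h0, h1⟩ := exists_GL_first_column ε hj₀
  have hε' : g⁻¹.1.mulVec (fun j => ιO (ε j)) = v₀ := by
    rw [← show g.1.mulVec v₀ = fun j => ιO (ε j) from funext hε, Matrix.mulVec_mulVec,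
      ← Units.val_mul, inv_mul_cancel, Units.val_one, Matrix.one_mulVec]
  refine ⟨κ, fun m n hn y => ?_⟩
  have hdet' : (toGL k κ).1.det = 1 := by
    rw [coe_toGL, ← RingHom.mapMatrix_apply, ← RingHom.map_det, hdet, map_one]
  have hmat : (g⁻¹ * toGL k (κ * upperRightHom (PowerSeries.X ^ m * y) * κ⁻¹) * g).1 - 1 =
      (ιO (PowerSeries.X ^ m * y) : k⸨X⸩) • (g⁻¹.1 * !![-(ιO (ε 0) * ιO (ε 1)), ιO (ε 0) ^ 2;
        -(ιO (ε 1) ^ 2), ιO (ε 0) * ιO (ε 1)] * g.1) := by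
    have h := conj_upperRightHom_of_det_eq_one (toGL k κ) hdet' (ιO (PowerSeries.X ^ m * y))
    rw [Matrix.GeneralLinearGroup.map_apply, Matrix.GeneralLinearGroup.map_apply, h0, h1] at h
    rw [map_mul, map_mul, map_inv, toGL_upperRightHom, Units.val_mul, Units.val_mul, h, mul_add,
      add_mul, mul_one, ← Units.val_mul, inv_mul_cancel, Units.val_one, add_sub_cancel_left,
      Matrix.mul_smul, Matrix.smul_mul]
  intro i v hv
  rw [hmat]
  -- The nilpotent matrix sends w to (ε₀w₁ - ε₁w₀)ε, and ε = g v₀; after conjugation its image is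
  -- therefore the line of v₀.
  have hact : ∀ w : Fin 2 → k⸨X⸩, (g⁻¹.1 * !![-(ιO (ε 0) * ιO (ε 1)), ιO (ε 0) ^ 2;
        -(ιO (ε 1) ^ 2), ιO (ε 0) * ιO (ε 1)] * g.1).mulVec w =
      (ιO (ε 0) * g.1.mulVec w 1 - ιO (ε 1) * g.1.mulVec w 0) • v₀ := by
    intro w
    rw [← hε', ← Matrix.mulVec_smul, ← Matrix.mulVec_mulVec, ← Matrix.mulVec_mulVec]
    congr 1
    generalize g.1.mulVec w = w'
    funext j
    fin_cases j
    · simp [Matrix.mulVec, dotProduct, Fin.sum_univ_two, -LaurentSeries.coe_algebraMap]; ring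
    · simp [Matrix.mulVec, dotProduct, Fin.sum_univ_two, -LaurentSeries.coe_algebraMap]; ring
  have hstab : ∀ i, ∀ v ∈ Λ.L i, (g⁻¹.1 * !![-(ιO (ε 0) * ιO (ε 1)), ιO (ε 0) ^ 2;
        -(ιO (ε 1) ^ 2), ιO (ε 0) * ιO (ε 1)] * g.1).mulVec v ∈ Λ.L i := by
    intro i v hv
    -- shift `i` into the window `i₀ - e < i ≤ i₀`
    obtain ⟨d, hd1, hd2⟩ : ∃ d : ℤ, i + d * Λ.e ≤ i₀ ∧ i₀ < i + d * Λ.e + Λ.e := by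
      refine ⟨(i₀ - i) / Λ.e, ?_, ?_⟩
      · have := Int.ediv_mul_le (i₀ - i) he.ne'
        omega
      · have := Int.lt_ediv_add_one_mul_self (i₀ - i) he
        rw [add_mul, one_mul] at this
        omega
    rw [← Λ.unif_zpow_smul_mem_iff d] at hv ⊢
    rw [← Matrix.mulVec_smul, hact]
    have hw := hint _ hd2 _ hv
    generalize unif k ^ d • v = w at hw hv ⊢
    obtain ⟨a, ha⟩ := mem_fracIdeal_zero.1 (hw 0)
    obtain ⟨b, hb⟩ := mem_fracIdeal_zero.1 (hw 1)
    -- The coefficient of v₀ is integral and the shifted index is at most i₀, so the image stays in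
    -- the lattice.
    rw [ha, hb, ← map_mul, ← map_mul, ← map_sub, algebraMap_smul]
    exact Λ.strictAnti.antitone hd1 (Submodule.smul_mem _ _ hv₀)
  -- The factor t^m shifts the chain by m·e ≥ n.
  have hv' := Submodule.smul_mem _ y (hstab i v hv)
  rw [← Λ.unif_zpow_smul_mem_iff m, ← algebraMap_X_pow, algebraMap_smul, smul_smul] at hv'
  rw [Matrix.smul_mulVec, algebraMap_smul]
  exact Λ.strictAnti.antitone (by exact_mod_cast Int.add_le_add_left (by exact_mod_cast hn) i) hv'

end Chains

/-! ### The level of the induced representation and of its twists -/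

section Level

variable {k : Type*} [Field k]

/-- Three successive strict inclusions before L₀ reaches tL₀ would contradict dimension two: vectors
chosen in the three gaps are linearly dependent over F. This bounds denominators of levels. -/
lemma LatticeChain.e_le_two (Λ : LatticeChain k) : Λ.e ≤ 2 := by
  by_contra he
  push Not at he
  have hex : ∀ i : Fin 3, ∃ v ∈ Λ.L ((i : ℕ) : ℤ), v ∉ Λ.L ((i : ℕ) + 1 : ℤ) := fun i =>
    SetLike.exists_of_lt (Λ.strictAnti (lt_add_one _))
  choose v hv hv' using hex
  have hdep : ¬ LinearIndependent k⸨X⸩ v := by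
    intro h
    have := h.fintype_card_le_finrank
    simp at this
  obtain ⟨c, hc, i₀, hi₀⟩ := Fintype.not_linearIndependent_iff.1 hdep
  obtain ⟨p₀, hp₀⟩ := Finite.exists_max fun i => Valued.v (c i)
  have hcp : c p₀ ≠ 0 := by
    intro h
    have := hp₀ i₀
    rw [h, map_zero, le_zero_iff, map_eq_zero] at this
    exact hi₀ this
  choose b hb using fun i => exists_eq_algebraMap_mul hcp (hp₀ i)
  have hsum : ∑ i, b i • v i = 0 := by
    have h1 : c p₀ • ∑ i, b i • v i = 0 := by
      rw [← hc, Finset.smul_sum]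
      refine Finset.sum_congr rfl fun i _ => ?_
      rw [← algebraMap_smul k⸨X⸩ (b i), smul_smul, hb i, mul_comm]
    exact (smul_eq_zero.1 h1).resolve_left hcp
  have hbp : PowerSeries.constantCoeff (b p₀) ≠ 0 := by
    have h1 : (ιO (b p₀) : k⸨X⸩) = 1 := by
      have := hb p₀
      exact mul_right_cancel₀ hcp (by rw [← this, one_mul])
    rw [← map_one (algebraMap k⟦X⟧ k⸨X⸩)] at h1
    rw [algebraMap_int_injective h1]
    simp
  -- In the normalized relation, p is the first index with a unit coefficient. Later terms lie in
  -- L_(p+1); earlier ones lie in tL_i = L_(i+e), also inside L_(p+1) since e ≥ 3. This puts v_p in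
  -- L_(p+1).
  obtain ⟨p, hp, hpmin⟩ : ∃ p, PowerSeries.constantCoeff (b p) ≠ 0 ∧
      ∀ i < p, PowerSeries.constantCoeff (b i) = 0 := by
    classical
    let s : Finset (Fin 3) := Finset.univ.filter fun i => PowerSeries.constantCoeff (b i) ≠ 0
    have hs : s.Nonempty := ⟨p₀, by simpa [s] using hbp⟩
    refine ⟨s.min' hs, by simpa [s] using s.min'_mem hs, fun i hi => ?_⟩
    by_contra h
    exact absurd (s.min'_le i (by simpa [s] using h)) (not_le.2 hi)
  obtain ⟨u, hu⟩ : IsUnit (b p) := PowerSeries.isUnit_iff_constantCoeff.2 hp.isUnit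
  have hmem : b p • v p ∈ Λ.L ((p : ℕ) + 1 : ℤ) := by
    have h1 := Finset.add_sum_erase Finset.univ (fun i => b i • v i) (Finset.mem_univ p)
    rw [hsum] at h1
    rw [eq_neg_of_add_eq_zero_left h1]
    refine Submodule.neg_mem _ (Submodule.sum_mem _ fun i hi => ?_)
    have hip := Finset.ne_of_mem_erase hi
    rcases lt_or_gt_of_ne hip with hlt | hgt
    · obtain ⟨d, hd⟩ := PowerSeries.X_dvd_iff.2 (hpmin i hlt)
      have h2 := Λ.unif_smul_mem_iff.2 (Submodule.smul_mem _ d (hv i))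
      rw [← show algebraMap k⟦X⟧ k⸨X⸩ PowerSeries.X = unif k from rfl, algebraMap_smul, smul_smul,
        ← hd] at h2
      exact Λ.strictAnti.antitone (by have := p.2; omega) h2
    · refine Λ.strictAnti.antitone ?_ (Submodule.smul_mem _ _ (hv i))
      have : (p : ℕ) < i := hgt
      omega
  have h3 := Submodule.smul_mem _ (u⁻¹ : k⟦X⟧ˣ).1 hmem
  rw [smul_smul, ← hu, Units.inv_mul, one_smul] at h3
  exact hv' p h3

variable {C W : Type*} [Field C] [AddCommGroup W] [Module C W] {m : ℕ}
  {ξ : Representation C (FiniteLevel k m) W} {Ξ : Representation C (ZK k) W}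

lemma exists_apply_ne_zero {f : cIndSpace (ZK k) Ξ} (hf : f ≠ 0) : ∃ g, f.1 g ≠ 0 := by
  by_contra h
  push Not at h
  exact hf (Subtype.ext (funext h))

/-- If n < m·e, then U^(n+1) contains g⁻¹κN^mκ⁻¹g, on which θ is trivial by the determinant
condition; so `f` vanishes at κ⁻¹g, hence at g. Allowing such θ treats all twists at once. -/
lemma le_of_containsCharOn
    (hN : ¬ ContainsCharOn ξ (unipFiltration k m m) (fun _ => 1))
    (hΞ : ∀ g : GL (Fin 2) k⟦X⟧, Ξ (toZK k g) = ξ (reduction k m g))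
    (Λ : LatticeChain k) (n : ℕ) (θ : GL (Fin 2) k⸨X⸩ → C)
    (hθ : ∀ u, Matrix.GeneralLinearGroup.det u = 1 → θ u = 1)
    (h : ContainsCharOn (cInd (ZK k) Ξ) (Λ.unitGroup (n + 1)) θ) : m * Λ.e ≤ n := by
  by_contra hlt
  push Not at hlt
  obtain ⟨f, hf0, hf⟩ := h
  obtain ⟨g, hg⟩ := exists_apply_ne_zero hf0
  obtain ⟨κ, hκ⟩ := Λ.exists_conj_mem_unitGroup g
  have h1 : f.1 (toGL k κ⁻¹ * g) = 0 := by
    refine cInd_eq_zero_of_forall_upperRightHom hN hΞ f _ fun y => ?_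
    have hdet : Matrix.GeneralLinearGroup.det
        (g⁻¹ * toGL k (κ * upperRightHom (PowerSeries.X ^ m * y) * κ⁻¹) * g) = 1 := by
      have hu : Matrix.GeneralLinearGroup.det (toGL k (upperRightHom (PowerSeries.X ^ m * y))) =
          1 := by
        rw [toGL_upperRightHom]
        refine Units.ext ?_
        rw [Matrix.GeneralLinearGroup.val_det_apply, Matrix.det_fin_two]
        simp
      simp only [map_mul, map_inv]
      rw [hu]
      simp [mul_comm]
    have h2 := hf _ (hκ m (n + 1) hlt y)
    rw [hθ _ hdet, one_smul] at h2
    have h3 := congrFun (congrArg Subtype.val h2) g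
    rw [cInd_apply] at h3
    have h4 := cInd_toGL_mul hΞ f κ⁻¹ (g * (g⁻¹ *
      toGL k (κ * upperRightHom (PowerSeries.X ^ m * y) * κ⁻¹) * g))
    rw [h3, ← cInd_toGL_mul hΞ] at h4
    rw [← h4]
    simp only [map_mul, map_inv]
    group
  rw [cInd_toGL_mul hΞ] at h1
  apply hg
  have h5 := congrArg (ξ (reduction k m κ)) h1
  rwa [map_zero, ← Module.End.mul_apply, ← map_mul, ← map_mul, mul_inv_cancel, map_one, map_one,
    Module.End.one_apply] at h5

lemma natCast_le_div_of_mul_le {a e n : ℕ} (he : 0 < e) (h : a * e ≤ n) :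
    (a : ℚ) ≤ (n : ℚ) / (e : ℚ) := by
  rw [le_div_iff₀ (by exact_mod_cast he)]
  exact_mod_cast h

lemma single_mem_fixedVectors
    (hΞ : ∀ g : GL (Fin 2) k⟦X⟧, Ξ (toZK k g) = ξ (reduction k m g)) (w : W)
    (u : GL (Fin 2) k⸨X⸩) (hu : u ∈ congruenceSubgroup k m) :
    cInd (ZK k) Ξ u (single hΞ w) = single hΞ w := by
  obtain ⟨κ, hκ, rfl⟩ := hu
  rw [cInd_toGL_single, show reduction k m κ = 1 from hκ, map_one, Module.End.one_apply]

theorem cInd_hasLevel [Nontrivial W]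
    (hN : ¬ ContainsCharOn ξ (unipFiltration k m m) (fun _ => 1))
    (hΞ : ∀ g : GL (Fin 2) k⟦X⟧, Ξ (toZK k g) = ξ (reduction k m g)) :
    HasLevel (cInd (ZK k) Ξ) m := by
  obtain ⟨w, hw⟩ := exists_ne (0 : W)
  refine ⟨⟨stdChain k, m, ⟨single hΞ w, single_ne_zero hΞ hw, fun u hu => ?_⟩, ?_⟩, ?_⟩
  · rw [one_smul, single_mem_fixedVectors hΞ w u (mem_stdChain_unitGroup_succ.1 hu)]
  · simp [stdChain]
  · rintro _ ⟨Λ, n, h, rfl⟩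
    exact natCast_le_div_of_mul_le Λ.e_pos
      (le_of_containsCharOn hN hΞ Λ n _ (fun _ _ => rfl) h)

/-- The minimum is attained because e is 1 or 2, so all the quotients are half-integers and
well-ordering of ℕ applies. -/
lemma exists_hasLevel_of_containsCharOn {V : Type*} [AddCommGroup V] [Module C V]
    (π : Representation C (GL (Fin 2) k⸨X⸩) V) {Λ : LatticeChain k} {n : ℕ}
    (h : ContainsCharOn π (Λ.unitGroup (n + 1)) (fun _ => 1)) : ∃ r, HasLevel π r := by
  classical
  set S := {x : ℚ | ∃ (Λ : LatticeChain k) (n : ℕ),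
    ContainsCharOn π (Λ.unitGroup (n + 1)) (fun _ => 1) ∧ x = (n : ℚ) / (Λ.e : ℚ)} with hS
  have hhalf : ∀ x ∈ S, ∃ a : ℕ, x = (a : ℚ) / 2 := by
    rintro _ ⟨Λ, n, -, rfl⟩
    have h1 := Λ.e_pos
    have h2 := Λ.e_le_two
    interval_cases Λ.e
    · exact ⟨2 * n, by push_cast; ring⟩
    · exact ⟨n, by push_cast; ring⟩
  have hex : ∃ a : ℕ, (a : ℚ) / 2 ∈ S := by
    obtain ⟨a, ha⟩ := hhalf _ ⟨Λ, n, h, rfl⟩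
    exact ⟨a, ha ▸ ⟨Λ, n, h, rfl⟩⟩
  refine ⟨(Nat.find hex : ℚ) / 2, Nat.find_spec hex, fun x hx => ?_⟩
  obtain ⟨a, rfl⟩ := hhalf x hx
  have : Nat.find hex ≤ a := Nat.find_min' hex hx
  have : (Nat.find hex : ℚ) ≤ a := by exact_mod_cast this
  linarith

theorem exists_hasLevel_twist [Nontrivial W]
    (hN : ¬ ContainsCharOn ξ (unipFiltration k m m) (fun _ => 1))
    (hΞ : ∀ g : GL (Fin 2) k⟦X⟧, Ξ (toZK k g) = ξ (reduction k m g))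
    (φ : k⸨X⸩ˣ →* Cˣ) (hφ : IsOpen (φ.ker : Set k⸨X⸩ˣ)) :
    ∃ r : ℚ, HasLevel (twist φ (cInd (ZK k) Ξ)) r ∧ (m : ℚ) ≤ r := by
  obtain ⟨w, hw⟩ := exists_ne (0 : W)
  have hopen : IsOpen ((φ.ker.comap Matrix.GeneralLinearGroup.det :
      Subgroup (GL (Fin 2) k⸨X⸩)) : Set (GL (Fin 2) k⸨X⸩)) :=
    hφ.preimage Matrix.GeneralLinearGroup.continuous_det
  obtain ⟨N, hNφ⟩ := exists_congruenceSubgroup_le hopen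
  have hcont : ContainsCharOn (twist φ (cInd (ZK k) Ξ))
      ((stdChain k).unitGroup (max m N + 1)) (fun _ => 1) := by
    refine ⟨single hΞ w, single_ne_zero hΞ hw, fun u hu => ?_⟩
    rw [mem_stdChain_unitGroup_succ] at hu
    have h1 : φ (Matrix.GeneralLinearGroup.det u) = 1 :=
      hNφ (congruenceSubgroup_antitone (le_max_right m N) hu)
    change (φ (Matrix.GeneralLinearGroup.det u) : C) • cInd (ZK k) Ξ u (single hΞ w) = _
    rw [h1, Units.val_one,
      single_mem_fixedVectors hΞ w u (congruenceSubgroup_antitone (le_max_left m N) hu)]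
  obtain ⟨r, hr⟩ := exists_hasLevel_of_containsCharOn _ hcont
  refine ⟨r, hr, ?_⟩
  obtain ⟨Λ, n, ⟨f, hf0, hf⟩, rfl⟩ := hr.1
  -- A vector fixed in the twist transforms under the untwisted representation by φ(det)⁻¹, trivial
  -- in determinant one.
  refine natCast_le_div_of_mul_le Λ.e_pos (le_of_containsCharOn hN hΞ Λ n
    (fun u => ((φ (Matrix.GeneralLinearGroup.det u))⁻¹ : Cˣ)) (fun u hu => by simp [hu])
    ⟨f, hf0, fun u hu => ?_⟩)
  have h1 : (φ (Matrix.GeneralLinearGroup.det u) : C) • cInd (ZK k) Ξ u f = (1 : C) • f := hf u hu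
  rw [one_smul] at h1
  rw [← h1, smul_smul, Units.inv_mul, one_smul, h1]

end Level

/-! ### The last layer of the congruence filtration -/

section OneAdd

/-- The matrix `1 + εA`, for `ε² = 0`. -/
def oneAdd {R : Type*} [CommRing R] {ε : R} (hε : ε * ε = 0) (A : Matrix (Fin 2) (Fin 2) R) :
    GL (Fin 2) R where
  val := 1 + ε • A
  inv := 1 - ε • A
  val_inv := by
    rw [add_mul, one_mul, mul_sub, mul_one, Matrix.smul_mul, Matrix.mul_smul, smul_smul, hε,
      zero_smul, sub_zero, sub_add_cancel]
  inv_val := by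
    rw [sub_mul, one_mul, mul_add, mul_one, Matrix.smul_mul, Matrix.mul_smul, smul_smul, hε,
      zero_smul, add_zero, add_sub_cancel_right]

lemma oneAdd_add {R : Type*} [CommRing R] {ε : R} (hε : ε * ε = 0)
    (A B : Matrix (Fin 2) (Fin 2) R) : oneAdd hε (A + B) = oneAdd hε A * oneAdd hε B := by
  refine Units.ext ?_
  change 1 + ε • (A + B) = (1 + ε • A) * (1 + ε • B)
  rw [add_mul, one_mul, mul_add, mul_one, Matrix.smul_mul, Matrix.mul_smul, smul_smul, hε,
    zero_smul, add_zero, smul_add]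
  abel

variable {k : Type*} [Field k] {m : ℕ}

lemma X_pow_sq_eq_zero (hm : 0 < m) :
    (Ideal.Quotient.mk _ (PowerSeries.X ^ m) : TruncRing k m) *
      Ideal.Quotient.mk _ (PowerSeries.X ^ m) = 0 := by
  rw [← map_mul, Ideal.Quotient.eq_zero_iff_mem, Ideal.mem_span_singleton, ← pow_add]
  exact pow_dvd_pow _ (by omega)

lemma X_pow_mul_eq (m : ℕ) (y : k⟦X⟧) :
    (Ideal.Quotient.mk _ (PowerSeries.X ^ m) : TruncRing k m) * Ideal.Quotient.mk _ y =
      Ideal.Quotient.mk _ (PowerSeries.X ^ m) *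
        Ideal.Quotient.mk _ (PowerSeries.C (PowerSeries.constantCoeff y)) := by
  rw [← map_mul, ← map_mul, Ideal.Quotient.eq, Ideal.mem_span_singleton, ← mul_sub, pow_succ]
  refine mul_dvd_mul_left _ (PowerSeries.X_dvd_iff.2 ?_)
  simp

/-- The element `1 + t^m A` of `GL₂(O_F / t^(m+1))`, for a matrix `A` over `k`. -/
noncomputable def lastLayer (hm : 0 < m) (A : Matrix (Fin 2) (Fin 2) k) : FiniteLevel k m :=
  oneAdd (X_pow_sq_eq_zero (k := k) hm) (A.map fun x => Ideal.Quotient.mk _ (PowerSeries.C x))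

lemma lastLayer_add (hm : 0 < m) (A B : Matrix (Fin 2) (Fin 2) k) :
    lastLayer hm (A + B) = lastLayer hm A * lastLayer hm B := by
  rw [lastLayer, lastLayer, lastLayer, ← oneAdd_add]
  congr 1
  refine Matrix.ext fun i j => ?_
  simp

lemma lastLayer_zero (hm : 0 < m) : lastLayer hm (0 : Matrix (Fin 2) (Fin 2) k) = 1 := by
  have h := lastLayer_add hm (0 : Matrix (Fin 2) (Fin 2) k) 0
  rw [add_zero] at h
  exact left_eq_mul.1 h

lemma reduction_eq_lastLayer (hm : 0 < m) {κ : GL (Fin 2) k⟦X⟧}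
    {B : Matrix (Fin 2) (Fin 2) k⟦X⟧} (hκ : κ.1 = 1 + (PowerSeries.X : k⟦X⟧) ^ m • B) :
    reduction k m κ = lastLayer hm (B.map PowerSeries.constantCoeff) := by
  refine Units.ext (Matrix.ext fun i j => ?_)
  change Ideal.Quotient.mk _ (κ.1 i j) = (1 : Matrix (Fin 2) (Fin 2) (TruncRing k m)) i j +
    Ideal.Quotient.mk _ (PowerSeries.X ^ m) *
      Ideal.Quotient.mk _ (PowerSeries.C (PowerSeries.constantCoeff (B i j)))
  rw [hκ, ← X_pow_mul_eq, Matrix.add_apply, Matrix.smul_apply, smul_eq_mul, RingHom.map_add,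
    RingHom.map_mul]
  congr 1
  rw [Matrix.one_apply, Matrix.one_apply]
  split_ifs <;> simp

variable {C W : Type*} [Field C] [AddCommGroup W] [Module C W]
  {ξ : Representation C (FiniteLevel k m) W}

/-- A vector on which the last layer acts through the character attached to `a`. -/
def IsLayerEigenvector (ξ : Representation C (FiniteLevel k m) W) (hm : 0 < m) (χ : AddChar k C)
    (a : Matrix (Fin 2) (Fin 2) k) (w : W) : Prop :=
  ∀ A : Matrix (Fin 2) (Fin 2) k, ξ (lastLayer hm A) w = χ (a * A).trace • w

/-- Nondegeneracy of the trace form makes a ↦ χ(-tr(aA)) a nontrivial character. -/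
lemma sum_addChar_trace [Finite k] [Fintype (Matrix (Fin 2) (Fin 2) k)] [CharZero C]
    {χ : AddChar k C} (hχ : χ ≠ 0) {A : Matrix (Fin 2) (Fin 2) k} (hA : A ≠ 0) :
    ∑ a : Matrix (Fin 2) (Fin 2) k, χ (-(a * A).trace) = 0 := by
  let F : Matrix (Fin 2) (Fin 2) k →+ k :=
    { toFun := fun a => -(a * A).trace
      map_zero' := by simp
      map_add' := fun a b => by rw [add_mul, Matrix.trace_add, neg_add] }
  have hne : χ.compAddMonoidHom F ≠ 0 := by
    intro h
    apply hχ
    obtain ⟨i, j, hij⟩ : ∃ i j, A i j ≠ 0 := by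
      by_contra h'
      push Not at h'
      exact hA (Matrix.ext h')
    ext x
    have h1 := DFunLike.congr_fun h (Matrix.single j i (-x / A i j))
    have h2 : F (Matrix.single j i (-x / A i j)) = x := by
      change -(Matrix.single j i (-x / A i j) * A).trace = x
      rw [Matrix.trace_single_mul, smul_eq_mul, div_mul_cancel₀ _ hij, neg_neg]
    rw [AddChar.compAddMonoidHom_apply, h2] at h1
    exact h1
  exact AddChar.sum_eq_zero_iff_ne_zero.2 hne

/-- Fourier inversion on M₂(k): the unnormalized isotypic components `P a` of w add up to |M₂(k)|·w
≠ 0, so one of them is nonzero. -/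
lemma exists_isLayerEigenvector [Finite k] [CharZero C] [Nontrivial W]
    (ξ : Representation C (FiniteLevel k m) W) (hm : 0 < m) {χ : AddChar k C} (hχ : χ ≠ 0) :
    ∃ (a : Matrix (Fin 2) (Fin 2) k) (w : W), w ≠ 0 ∧ IsLayerEigenvector ξ hm χ a w := by
  have := Fintype.ofFinite (Matrix (Fin 2) (Fin 2) k)
  classical
  obtain ⟨w, hw⟩ := exists_ne (0 : W)
  let P : Matrix (Fin 2) (Fin 2) k → W := fun a =>
    ∑ A : Matrix (Fin 2) (Fin 2) k, χ (-(a * A).trace) • ξ (lastLayer hm A) w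
  have hsum : ∑ a, P a = (Fintype.card (Matrix (Fin 2) (Fin 2) k) : C) • w := by
    simp only [P]
    rw [Finset.sum_comm]
    simp only [← Finset.sum_smul]
    rw [Finset.sum_eq_single (0 : Matrix (Fin 2) (Fin 2) k)]
    · simp [lastLayer_zero]
    · intro A _ hA
      rw [sum_addChar_trace hχ hA, zero_smul]
    · simp
  obtain ⟨a, ha⟩ : ∃ a, P a ≠ 0 := by
    by_contra h
    push Not at h
    rw [Finset.sum_congr rfl fun a _ => h a, Finset.sum_const_zero] at hsum
    exact smul_ne_zero (Nat.cast_ne_zero.2 Fintype.card_ne_zero) hw hsum.symm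
  refine ⟨a, P a, ha, fun B => ?_⟩
  simp only [P]
  rw [map_sum, Finset.smul_sum]
  refine Fintype.sum_equiv (Equiv.addLeft B) _ _ fun A => ?_
  rw [map_smul, ← Module.End.mul_apply, ← map_mul, ← lastLayer_add, Equiv.coe_addLeft, smul_smul,
    ← AddChar.map_add_eq_mul, mul_add, Matrix.trace_add]
  congr 2
  ring

/-- Let v be an eigenvector of `a` over k and A the nilpotent matrix with image and kernel kv. Then
tr(aA) = 0, so the group of all 1 + t^m xA fixes w. That group is conjugate to N_m^m by a κ with
first column v, contradicting `hN`. -/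
lemma IsLayerEigenvector.eval_charpoly_ne_zero {hm : 0 < m} {χ : AddChar k C}
    {a : Matrix (Fin 2) (Fin 2) k} {w : W} (h : IsLayerEigenvector ξ hm χ a w) (hw : w ≠ 0)
    (hN : ¬ ContainsCharOn ξ (unipFiltration k m m) (fun _ => 1)) (l : k) :
    a.charpoly.eval l ≠ 0 := by
  intro hl
  rw [Matrix.eval_charpoly] at hl
  obtain ⟨v, hv0, hv⟩ := Matrix.exists_mulVec_eq_zero_iff.2 hl
  obtain ⟨j, hj⟩ := Function.ne_iff.1 hv0
  obtain ⟨κ, hdet, h0, h1⟩ := exists_GL_first_column (fun j => PowerSeries.C (v j)) (j := j)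
    (by simpa using hj)
  have hdet' : (reduction k m κ).1.det = 1 := by
    change ((κ.1).map (Ideal.Quotient.mk _)).det = 1
    rw [← RingHom.mapMatrix_apply, ← RingHom.map_det, hdet, map_one]
  have hconj : ∀ y : k⟦X⟧,
      reduction k m κ * reduction k m (upperRightHom (PowerSeries.X ^ m * y)) *
        (reduction k m κ)⁻¹ = lastLayer hm (PowerSeries.constantCoeff y •
          !![-(v 0 * v 1), v 0 ^ 2; -(v 1 ^ 2), v 0 * v 1]) := by
    intro y
    refine Units.ext ?_
    have h0' : reduction k m κ 0 0 = Ideal.Quotient.mk _ (PowerSeries.C (v 0)) := by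
      rw [← h0]; rfl
    have h1' : reduction k m κ 1 0 = Ideal.Quotient.mk _ (PowerSeries.C (v 1)) := by
      rw [← h1]; rfl
    rw [reduction_upperRightHom, conj_upperRightHom_of_det_eq_one _ hdet', h0', h1',
      RingHom.map_mul, X_pow_mul_eq]
    change _ = 1 + _ • _
    congr 1
    refine Matrix.ext fun i j => ?_
    rw [Matrix.smul_apply, Matrix.smul_apply, smul_eq_mul, smul_eq_mul, mul_assoc]
    congr 1
    fin_cases i <;> fin_cases j <;> simp <;> exact mul_neg _ _
  have htr : ∀ x : k, (a * (x • !![-(v 0 * v 1), v 0 ^ 2; -(v 1 ^ 2), v 0 * v 1])).trace = 0 := by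
    intro x
    have e0 := congrFun hv 0
    have e1 := congrFun hv 1
    simp [Matrix.mulVec, dotProduct, Fin.sum_univ_two] at e0 e1
    simp [Matrix.trace_fin_two, Matrix.mul_apply, Fin.sum_univ_two]
    linear_combination x * v 1 * e0 - x * v 0 * e1
  have hfix : ξ (reduction k m κ)⁻¹ w = 0 := by
    refine eq_zero_of_forall_upperRightHom hN fun y => ?_
    have h2 := h (PowerSeries.constantCoeff y •
          !![-(v 0 * v 1), v 0 ^ 2; -(v 1 ^ 2), v 0 * v 1])
    rw [htr, AddChar.map_zero_eq_one, one_smul, ← hconj y] at h2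
    have h3 := congrArg (ξ (reduction k m κ)⁻¹) h2
    rw [← Module.End.mul_apply, ← map_mul] at h3
    rw [← Module.End.mul_apply, ← map_mul]
    rwa [mul_assoc, inv_mul_cancel_left] at h3
  apply hw
  have h4 := congrArg (ξ (reduction k m κ)) hfix
  rwa [map_zero, ← Module.End.mul_apply, ← map_mul, mul_inv_cancel, map_one,
    Module.End.one_apply] at h4

lemma irreducible_charpoly_of_eval_ne_zero {a : Matrix (Fin 2) (Fin 2) k}
    (h : ∀ l, a.charpoly.eval l ≠ 0) : Irreducible a.charpoly := by
  have hdeg : a.charpoly.natDegree = 2 := by rw [Matrix.charpoly_natDegree_eq_dim]; rfl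
  rw [(Matrix.charpoly_monic a).irreducible_iff_roots_eq_zero_of_degree_le_three
    (by omega) (by omega)]
  refine Multiset.eq_zero_of_forall_notMem fun l hl => h l ?_
  exact Polynomial.IsRoot.def.1 (Polynomial.isRoot_of_mem_roots hl)

end OneAdd

/-! ### Strata -/

section Strata

variable {k C W : Type*} [Field k] [Field C] [AddCommGroup W] [Module C W] {m : ℕ}
  {ξ : Representation C (FiniteLevel k m) W} {Ξ : Representation C (ZK k) W}

/-- The additive character of `k` induced by a character of `F` of level one. -/
noncomputable def residueChar (ψ : AddChar k⸨X⸩ C) : AddChar k C :=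
  ψ.compAddMonoidHom (((algebraMap k⟦X⟧ k⸨X⸩).comp PowerSeries.C : k →+* k⸨X⸩) : k →+ k⸨X⸩)

lemma IsLevelOne.apply_algebraMap {ψ : AddChar k⸨X⸩ C} (hψ : IsLevelOne ψ) (y : k⟦X⟧) :
    ψ (ιO y) = residueChar ψ (PowerSeries.constantCoeff y) := by
  obtain ⟨z, hz⟩ : PowerSeries.X ∣ y - PowerSeries.C (PowerSeries.constantCoeff y) :=
    PowerSeries.X_dvd_iff.2 (by simp)
  rw [sub_eq_iff_eq_add] at hz
  conv_lhs => rw [hz]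
  rw [RingHom.map_add, AddChar.map_add_eq_mul, hψ.1, one_mul]
  rfl

lemma IsLevelOne.residueChar_ne_zero {ψ : AddChar k⸨X⸩ C} (hψ : IsLevelOne ψ) :
    residueChar ψ ≠ 0 := by
  intro h
  obtain ⟨y, hy⟩ := hψ.2
  rw [hψ.apply_algebraMap, h] at hy
  exact hy rfl

/-- The factors t^(-n) and t^n cancel, and a level one character sees only the residue of the
integral trace left over. -/
lemma IsLevelOne.apply_trace {ψ : AddChar k⸨X⸩ C} (hψ : IsLevelOne ψ) {n : ℕ}
    (b B : Matrix (Fin 2) (Fin 2) k⟦X⟧) {κ : GL (Fin 2) k⟦X⟧}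
    (hκ : κ.1 = 1 + (PowerSeries.X : k⟦X⟧) ^ n • B) :
    ψ ((unif k ^ (-(n : ℤ)) • b.map ιO) * ((toGL k κ).1 - 1)).trace =
      residueChar ψ (b.map PowerSeries.constantCoeff * B.map PowerSeries.constantCoeff).trace := by
  have h1 : (toGL k κ).1 - 1 = unif k ^ (n : ℤ) • B.map ιO := by
    rw [coe_toGL, hκ]
    refine Matrix.ext fun i j => ?_
    rw [Matrix.sub_apply, Matrix.map_apply, Matrix.add_apply, RingHom.map_add, Matrix.smul_apply,
      Matrix.smul_apply, smul_eq_mul, RingHom.map_mul, algebraMap_X_pow, smul_eq_mul,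
      Matrix.map_apply, Matrix.one_apply, Matrix.one_apply]
    split_ifs <;> simp
  rw [h1, Matrix.smul_mul, Matrix.mul_smul, smul_smul, ← zpow_add₀ (unif_ne_zero k),
    neg_add_cancel, zpow_zero, one_smul, ← Matrix.map_mul, ← Matrix.map_mul]
  have h2 : ∀ (S : Type _) [CommRing S] (f : k⟦X⟧ →+* S), ((b * B).map f).trace =
      f (b * B).trace := fun S _ f => (AddMonoidHom.map_trace f.toAddMonoidHom (b * B)).symm
  rw [h2, h2, hψ.apply_algebraMap]

theorem exists_unramifiedSimple_stratum [Finite k] [CharZero C] [Nontrivial W] (hm : 0 < m)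
    (hN : ¬ ContainsCharOn ξ (unipFiltration k m m) (fun _ => 1))
    (hΞ : ∀ g : GL (Fin 2) k⟦X⟧, Ξ (toZK k g) = ξ (reduction k m g))
    {ψ : AddChar k⸨X⸩ C} (hψ : IsLevelOne ψ) :
    ∃ s : Stratum k, s.chain = stdChain k ∧ s.n = m ∧
      s.IsUnramifiedSimple ∧ ContainsStratum ψ (cInd (ZK k) Ξ) s := by
  obtain ⟨a, w, hw, ha⟩ := exists_isLayerEigenvector ξ hm hψ.residueChar_ne_zero
  -- The stratum is given by t^(-m) times the constant lift of `a`.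
  let b : Matrix (Fin 2) (Fin 2) k⟦X⟧ := a.map PowerSeries.C
  have hb : b.map PowerSeries.constantCoeff = a := Matrix.ext fun i j => by simp [b]
  refine ⟨⟨stdChain k, m, hm, unif k ^ (-(m : ℤ)) • b.map ιO, ?_⟩, rfl, rfl, ⟨rfl, a.charpoly,
    ⟨b.charpoly, ?_, ?_⟩, ?_⟩, single hΞ w, single_ne_zero hΞ hw, fun u hu => ?_⟩
  · rw [mem_stdChain_radPow]
    exact fun i j => ⟨b i j, rfl⟩
  · change _ = (unif k ^ m • unif k ^ (-(m : ℤ)) • b.map ιO).charpoly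
    rw [smul_smul, ← zpow_natCast, ← zpow_add₀ (unif_ne_zero k), add_neg_cancel, zpow_zero,
      one_smul, ← Matrix.charpoly_map]
  · rw [← Matrix.charpoly_map]
    exact congrArg Matrix.charpoly hb.symm
  · exact irreducible_charpoly_of_eval_ne_zero fun l => ha.eval_charpoly_ne_zero hw hN l
  · obtain ⟨B, κ, hκ, rfl⟩ := exists_toGL_eq hm u (mem_stdChain_unitGroup.1 hu)
    rw [cInd_toGL_single, reduction_eq_lastLayer hm hκ, ha, map_smul]
    beta_reduce
    rw [hψ.apply_trace b B hκ, hb]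

/-! #### Essentially scalar strata -/

section Transform

lemma cInd_conj_character {ψ : AddChar k⸨X⸩ C} {S : Set (GL (Fin 2) k⸨X⸩)}
    {a : Matrix (Fin 2) (Fin 2) k⸨X⸩} {f : cIndSpace (ZK k) Ξ}
    (hf : ∀ u ∈ S, cInd (ZK k) Ξ u f = ψ (a * (u.1 - 1)).trace • f)
    (g u : GL (Fin 2) k⸨X⸩) (hu : g⁻¹ * u * g ∈ S) :
    cInd (ZK k) Ξ u (cInd (ZK k) Ξ g f) =
      ψ (g.1 * a * g⁻¹.1 * (u.1 - 1)).trace • cInd (ZK k) Ξ g f := by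
  have h1 := congrArg (cInd (ZK k) Ξ g) (hf _ hu)
  rw [← Module.End.mul_apply, ← map_mul, map_smul, mul_assoc, mul_inv_cancel_left, map_mul,
    Module.End.mul_apply] at h1
  rw [h1]
  congr 2
  have h2 : (g⁻¹ * (u * g)).1 - 1 = g⁻¹.1 * (u.1 - 1) * g.1 := by
    rw [mul_sub, sub_mul, mul_one, ← Units.val_mul, ← Units.val_mul, ← Units.val_mul,
      inv_mul_cancel, Units.val_one, mul_assoc]
  rw [h2, ← mul_assoc, Matrix.trace_mul_comm]
  simp only [mul_assoc]

lemma charpoly_conj (g : GL (Fin 2) k⸨X⸩) (a : Matrix (Fin 2) (Fin 2) k⸨X⸩) :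
    (g.1 * a * g⁻¹.1).charpoly = a.charpoly := by
  rw [Matrix.coe_units_inv, Matrix.charpoly_units_conj]

lemma toGL_entry_mem (κ : GL (Fin 2) k⟦X⟧) (i j : Fin 2) :
    (toGL k κ).1 i j ∈ fracIdeal k 0 := mem_fracIdeal_zero.2 ⟨κ.1 i j, rfl⟩

lemma mul_entry_mem_fracIdeal {x y : Matrix (Fin 2) (Fin 2) k⸨X⸩} {a b : ℤ}
    (hx : ∀ i j, x i j ∈ fracIdeal k a) (hy : ∀ i j, y i j ∈ fracIdeal k b) (i j : Fin 2) :
    (x * y) i j ∈ fracIdeal k (a + b) := by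
  rw [Matrix.mul_apply]
  exact Submodule.sum_mem _ fun l _ => mul_mem_fracIdeal (hx i l) (hy l j)

lemma toGL_conj_entry_mem (κ : GL (Fin 2) k⟦X⟧) {x : Matrix (Fin 2) (Fin 2) k⸨X⸩} {n : ℤ}
    (hx : ∀ i j, x i j ∈ fracIdeal k n) (i j : Fin 2) :
    ((toGL k κ).1 * x * (toGL k κ)⁻¹.1) i j ∈ fracIdeal k n := by
  have := mul_entry_mem_fracIdeal (mul_entry_mem_fracIdeal (toGL_entry_mem κ) hx)
    (toGL_entry_mem κ⁻¹) i j
  rwa [zero_add, add_zero, map_inv] at this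

/-- The columns of γ form an O_F-basis of L₀. Period one gives L_i = t^i L₀, so γ carries the
standard chain onto Λ. -/
lemma LatticeChain.exists_GL_of_e_eq_one (Λ : LatticeChain k) (he : Λ.e = 1) :
    ∃ γ : GL (Fin 2) k⸨X⸩, ∀ (n : ℤ) (x : Matrix (Fin 2) (Fin 2) k⸨X⸩),
      x ∈ Λ.radPow n ↔ γ⁻¹.1 * x * γ.1 ∈ (stdChain k).radPow n := by
  have := Λ.isLattice 0
  have hfree : Module.Free k⟦X⟧ (Λ.L 0) := Submodule.IsLattice.free k⸨X⸩ _
  have hrank : Module.finrank k⟦X⟧ (Λ.L 0) = 2 := by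
    rw [Submodule.IsLattice.finrank_of_pi k⸨X⸩ (Λ.L 0), Fintype.card_fin]
  let b : Module.Basis (Fin 2) k⟦X⟧ (Λ.L 0) := Module.finBasisOfFinrankEq _ _ hrank
  let b' : Module.Basis (Fin 2) k⸨X⸩ (Fin 2 → k⸨X⸩) := b.extendOfIsLattice k⸨X⸩
  let A : Matrix (Fin 2) (Fin 2) k⸨X⸩ := Matrix.of fun i j => (b j).1 i
  have hA : IsUnit A := by
    rw [← Matrix.linearIndependent_cols_iff_isUnit]
    have : A.col = b' := funext fun j => (b.extendOfIsLattice_apply k⸨X⸩ j).symm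
    rw [this]
    exact b'.linearIndependent
  obtain ⟨γ, hγ⟩ := hA
  have hcol : ∀ c : Fin 2 → k⸨X⸩, γ.1.mulVec c = ∑ j, c j • (b j).1 := by
    intro c
    rw [hγ]
    funext i
    simp [Matrix.mulVec, dotProduct, A, mul_comm]
  have h0 : ∀ c : Fin 2 → k⸨X⸩, γ.1.mulVec c ∈ Λ.L 0 ↔ ∀ j, c j ∈ fracIdeal k 0 := by
    intro c
    rw [hcol]
    constructor
    · intro h
      have h1 := b.sum_repr ⟨_, h⟩
      have h2 := congrArg Subtype.val h1
      simp only [AddSubmonoidClass.coe_finsetSum, SetLike.val_smul] at h2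
      have h3 : ∑ j, (c j - ιO (b.repr ⟨_, h⟩ j)) • b' j = 0 := by
        simp only [sub_smul, Finset.sum_sub_distrib, algebraMap_smul]
        simp only [b', b.extendOfIsLattice_apply k⸨X⸩]
        rw [h2, sub_self]
      have h4 := Fintype.linearIndependent_iff.1 b'.linearIndependent _ h3
      exact fun j => mem_fracIdeal_zero.2 ⟨_, sub_eq_zero.1 (h4 j)⟩
    · intro h
      refine Submodule.sum_mem _ fun j _ => ?_
      obtain ⟨d, hd⟩ := mem_fracIdeal_zero.1 (h j)
      rw [hd, algebraMap_smul]
      exact Submodule.smul_mem _ _ (b j).2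
  have hmem : ∀ (i : ℤ) (c : Fin 2 → k⸨X⸩), γ.1.mulVec c ∈ Λ.L i ↔ c ∈ (stdChain k).L i := by
    intro i c
    have h1 := Λ.unif_zpow_smul_mem_iff (i := i) (v := γ.1.mulVec c) (-i)
    rw [he, Nat.cast_one, mul_one, add_neg_cancel, ← Matrix.mulVec_smul, h0] at h1
    rw [← h1, mem_stdChain_L]
    refine forall_congr' fun j => ?_
    rw [Pi.smul_apply, smul_eq_mul, unif_zpow_mul_mem_fracIdeal, zero_sub, neg_neg]
  refine ⟨γ, fun n x => ?_⟩
  have hinv : ∀ v, γ.1.mulVec (γ⁻¹.1.mulVec v) = v := fun v => by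
    rw [Matrix.mulVec_mulVec, ← Units.val_mul, mul_inv_cancel, Units.val_one, Matrix.one_mulVec]
  constructor
  · intro h i v hv
    rw [← hmem, ← Matrix.mulVec_mulVec, ← Matrix.mulVec_mulVec, hinv]
    exact h i _ ((hmem i v).2 hv)
  · intro h i v hv
    rw [← hinv v, hmem] at hv
    have h1 := h i _ hv
    rwa [← hmem, ← Matrix.mulVec_mulVec, ← Matrix.mulVec_mulVec, hinv, hinv] at h1

/-- Comparison of the two actions on the value of `f` at `diagPow k j`. -/
lemma apply_eq_residueChar_smul
    (hΞ : ∀ g : GL (Fin 2) k⟦X⟧, Ξ (toZK k g) = ξ (reduction k m g))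
    {ψ : AddChar k⸨X⸩ C} (hψ : IsLevelOne ψ) {n : ℕ}
    {b : Matrix (Fin 2) (Fin 2) k⟦X⟧} {f : cIndSpace (ZK k) Ξ}
    (hf : ∀ u ∈ (stdChain k).unitGroup n, cInd (ZK k) Ξ u f =
      ψ ((unif k ^ (-(n : ℤ)) • b.map ιO) * (u.1 - 1)).trace • f)
    {j : ℕ} {κ κ' : GL (Fin 2) k⟦X⟧} {B : Matrix (Fin 2) (Fin 2) k⟦X⟧}
    (hκ : κ.1 = 1 + (PowerSeries.X : k⟦X⟧) ^ n • B)
    (hκ' : toGL k κ' * diagPow k j = diagPow k j * toGL k κ) :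
    ξ (reduction k m κ') (f.1 (diagPow k j)) =
      residueChar ψ (b.map PowerSeries.constantCoeff * B.map PowerSeries.constantCoeff).trace •
        f.1 (diagPow k j) := by
  have hu : toGL k κ ∈ (stdChain k).unitGroup n := by
    rw [mem_stdChain_unitGroup]
    intro i l
    refine ⟨B i l, ?_⟩
    rw [coe_toGL, hκ, Matrix.sub_apply, Matrix.map_apply, Matrix.add_apply, RingHom.map_add,
      Matrix.smul_apply, smul_eq_mul, RingHom.map_mul, algebraMap_X_pow, Matrix.one_apply,
      Matrix.one_apply]
    split_ifs <;> simp
  have h1 := congrFun (congrArg Subtype.val (hf _ hu)) (diagPow k j)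
  rw [cInd_apply, ← hκ', cInd_toGL_mul hΞ, hψ.apply_trace b B hκ] at h1
  exact h1

lemma eq_zero_of_forall_addChar_mul_eq_one {χ : AddChar k C} (hχ : χ ≠ 0) {c : k}
    (h : ∀ z, χ (c * z) = 1) : c = 0 := by
  by_contra hc
  apply hχ
  ext z
  have := h (c⁻¹ * z)
  rwa [mul_inv_cancel_left₀ hc] at this

lemma exists_GL_one_add {n : ℕ} (hn : 0 < n) (B : Matrix (Fin 2) (Fin 2) k⟦X⟧) :
    ∃ κ : GL (Fin 2) k⟦X⟧, κ.1 = 1 + (PowerSeries.X : k⟦X⟧) ^ n • B := by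
  have hA : IsUnit (1 + (PowerSeries.X : k⟦X⟧) ^ n • B).det := by
    rw [PowerSeries.isUnit_iff_constantCoeff, Matrix.det_fin_two]
    simp [hn.ne']
  exact ⟨Matrix.GeneralLinearGroup.mk'' _ hA, rfl⟩

lemma reduction_eq_one {n : ℕ} (hn : m < n) {κ : GL (Fin 2) k⟦X⟧}
    {B : Matrix (Fin 2) (Fin 2) k⟦X⟧} (hκ : κ.1 = 1 + (PowerSeries.X : k⟦X⟧) ^ n • B) :
    reduction k m κ = 1 := by
  rw [← map_one (reduction k m), reduction_eq_iff]
  intro i j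
  rw [hκ]
  exact (pow_dvd_pow _ hn).trans ⟨B i j, by simp⟩

/-- Three ranges of n, assuming a nonzero value. If n < m + j, N^m becomes N^(m+j), where the
character is trivial, against `hN`. If n = m, then j = 0 and the value is a layer eigenvector whose
matrix has the eigenvalue c. If n > m, elements 1 + t^n B' act trivially through `ξ`, which forces
the first row of the reduced b to vanish, against determinant c² ≠ 0. -/
lemma not_transform_of_charpoly_eq (hm : 0 < m)
    (hN : ¬ ContainsCharOn ξ (unipFiltration k m m) (fun _ => 1))
    (hΞ : ∀ g : GL (Fin 2) k⟦X⟧, Ξ (toZK k g) = ξ (reduction k m g))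
    {ψ : AddChar k⸨X⸩ C} (hψ : IsLevelOne ψ) {n : ℕ} (hn : 0 < n)
    {b : Matrix (Fin 2) (Fin 2) k⟦X⟧} {f : cIndSpace (ZK k) Ξ}
    (hf : ∀ u ∈ (stdChain k).unitGroup n, cInd (ZK k) Ξ u f =
      ψ ((unif k ^ (-(n : ℤ)) • b.map ιO) * (u.1 - 1)).trace • f)
    {c : k} (hc : c ≠ 0) (hb : (b.map PowerSeries.constantCoeff).charpoly =
      (Polynomial.X - Polynomial.C c) ^ 2) (j : ℕ) : f.1 (diagPow k j) = 0 := by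
  by_contra hw
  rcases lt_or_ge n (m + j) with hlt | hge
  · refine hw (eq_zero_of_forall_upperRightHom hN fun y => ?_)
    obtain ⟨d, hd⟩ := Nat.exists_eq_add_of_lt hlt
    have h1 := apply_eq_residueChar_smul hΞ hψ hf
      (B := !![0, PowerSeries.X ^ (d + 1) * y; 0, 0])
      (κ := upperRightHom (PowerSeries.X ^ m * y * PowerSeries.X ^ j)) (by
        have h2 : (PowerSeries.X : k⟦X⟧) ^ m * y * PowerSeries.X ^ j =
            PowerSeries.X ^ n * (PowerSeries.X ^ (d + 1) * y) := by
          rw [mul_right_comm, ← pow_add, hd, add_assoc, pow_add, mul_assoc]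
        rw [h2]
        refine Matrix.ext fun i l => ?_
        fin_cases i <;> fin_cases l <;> simp) (toGL_upperRightHom_mul_diagPow _ j)
    rw [h1]
    have h0 : (!![0, PowerSeries.X ^ (d + 1) * y; 0, 0] : Matrix (Fin 2) (Fin 2) k⟦X⟧).map
        PowerSeries.constantCoeff = 0 := by
      refine Matrix.ext fun i l => ?_
      fin_cases i <;> fin_cases l <;> simp
    rw [h0, mul_zero, Matrix.trace_zero, AddChar.map_zero_eq_one, one_smul]
  · rcases eq_or_lt_of_le (show m ≤ n by omega) with rfl | hmn
    · obtain rfl : j = 0 := by omega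
      have heig : IsLayerEigenvector ξ hm (residueChar ψ) (b.map PowerSeries.constantCoeff)
          (f.1 (diagPow k 0)) := by
        intro A
        obtain ⟨κ, hκ⟩ := exists_GL_one_add hm (A.map PowerSeries.C)
        have hA : (A.map PowerSeries.C).map PowerSeries.constantCoeff = A :=
          Matrix.ext fun i l => by simp
        have h1 := apply_eq_residueChar_smul hΞ hψ hf (j := 0) (κ' := κ) hκ
          (by rw [diagPow_zero, mul_one, one_mul])
        rwa [reduction_eq_lastLayer hm hκ, hA] at h1
      refine heig.eval_charpoly_ne_zero hw hN c ?_
      rw [hb]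
      simp
    · have key : ∀ {κ κ' : GL (Fin 2) k⟦X⟧} {B B' : Matrix (Fin 2) (Fin 2) k⟦X⟧},
          κ.1 = 1 + (PowerSeries.X : k⟦X⟧) ^ n • B →
          κ'.1 = 1 + (PowerSeries.X : k⟦X⟧) ^ n • B' →
          toGL k κ' * diagPow k j = diagPow k j * toGL k κ →
          residueChar ψ (b.map PowerSeries.constantCoeff *
            B.map PowerSeries.constantCoeff).trace = 1 := by
        intro κ κ' B B' hκ hκ' h
        have h1 := apply_eq_residueChar_smul hΞ hψ hf hκ h
        rw [reduction_eq_one hmn hκ', map_one, Module.End.one_apply] at h1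
        by_contra hne
        have h2 : (residueChar ψ (b.map PowerSeries.constantCoeff *
            B.map PowerSeries.constantCoeff).trace - 1) • f.1 (diagPow k j) = 0 := by
          rw [sub_smul, one_smul, ← h1, sub_self]
        exact (smul_ne_zero (sub_ne_zero.2 hne) hw) h2
      -- Diagonal test matrices commute with diag(1, t^j) and isolate this entry.
      have h00 : PowerSeries.constantCoeff (b 0 0) = 0 := by
        refine eq_zero_of_forall_addChar_mul_eq_one hψ.residueChar_ne_zero fun z => ?_
        obtain ⟨κ, hκ⟩ := exists_GL_one_add hn !![PowerSeries.C z, 0; 0, 0]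
        have h1 := key hκ hκ (by
          refine Units.ext (Matrix.ext fun i l => ?_)
          rw [Units.val_mul, Units.val_mul, coe_toGL, hκ, coe_diagPow]
          fin_cases i <;> fin_cases l <;> simp [Matrix.mul_apply, Fin.sum_univ_two])
        rw [Matrix.trace_fin_two] at h1
        simpa [Matrix.mul_apply, Fin.sum_univ_two] using h1
      -- Lower unipotents gain t^j when moved to the left, so they remain congruent to 1 modulo t^n
      -- on both sides; the trace pairs them with this entry.
      have h01 : PowerSeries.constantCoeff (b 0 1) = 0 := by
        refine eq_zero_of_forall_addChar_mul_eq_one hψ.residueChar_ne_zero fun z => ?_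
        have h1 := key (κ := lowerLeft (PowerSeries.X ^ n * PowerSeries.C z))
          (κ' := lowerLeft (PowerSeries.X ^ j * (PowerSeries.X ^ n * PowerSeries.C z)))
          (B := !![0, 0; PowerSeries.C z, 0])
          (B' := !![0, 0; PowerSeries.X ^ j * PowerSeries.C z, 0])
          (by
            refine Matrix.ext fun i l => ?_
            fin_cases i <;> fin_cases l <;> simp [lowerLeft])
          (by
            refine Matrix.ext fun i l => ?_
            fin_cases i <;> fin_cases l <;> simp [lowerLeft]
            ring)
          (by
            rw [toGL_lowerLeft, toGL_lowerLeft, ← lowerLeft_mul_diagPow, RingHom.map_mul,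
              algebraMap_X_pow, zpow_natCast])
        rw [Matrix.trace_fin_two] at h1
        simpa [Matrix.mul_apply, Fin.sum_univ_two] using h1
      have hdet := congrArg (Polynomial.eval 0) hb
      rw [Matrix.eval_charpoly, Matrix.det_fin_two] at hdet
      simp [h00, h01] at hdet
      exact pow_ne_zero 2 hc hdet.symm

/-- Conjugating by γ moves the stratum to the standard chain, and by κ from a Cartan decomposition
moves the nonvanishing to diag(1, t^j). Both keep the characteristic polynomial, and integrality of
t^n a in the standard order survives κ in K. -/
theorem not_containsStratum_of_isEssentiallyScalar (hm : 0 < m)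
    (hN : ¬ ContainsCharOn ξ (unipFiltration k m m) (fun _ => 1))
    (hΞ : ∀ g : GL (Fin 2) k⟦X⟧, Ξ (toZK k g) = ξ (reduction k m g))
    {ψ : AddChar k⸨X⸩ C} (hψ : IsLevelOne ψ) (s : Stratum k) (hs : s.IsEssentiallyScalar) :
    ¬ ContainsStratum ψ (cInd (ZK k) Ξ) s := by
  rintro ⟨f, hf0, hf⟩
  obtain ⟨he, c, hc, F, hF, hFc⟩ := hs
  obtain ⟨γ, hγ⟩ := s.chain.exists_GL_of_e_eq_one he
  have hf0' : cInd (ZK k) Ξ γ⁻¹ f ≠ 0 := by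
    intro h
    apply hf0
    have := congrArg (cInd (ZK k) Ξ γ) h
    rwa [map_zero, ← Module.End.mul_apply, ← map_mul, mul_inv_cancel, map_one,
      Module.End.one_apply] at this
  obtain ⟨g, hg⟩ := exists_apply_ne_zero hf0'
  obtain ⟨ζ, hζ, j, κ, rfl⟩ := exists_cartan g
  have hstd : ∀ u ∈ (stdChain k).unitGroup s.n, cInd (ZK k) Ξ u (cInd (ZK k) Ξ γ⁻¹ f) =
      ψ (γ⁻¹.1 * s.a * γ.1 * (u.1 - 1)).trace • cInd (ZK k) Ξ γ⁻¹ f := by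
    intro u hu
    have h1 := cInd_conj_character hf γ⁻¹ u (by
      change _ ∈ s.chain.radPow s.n
      rw [hγ]
      convert hu using 1
      rw [inv_inv, mul_sub, sub_mul, mul_one, Units.val_mul, Units.val_mul]
      simp only [← mul_assoc]
      rw [← Units.val_mul, inv_mul_cancel, Units.val_one, one_mul, mul_assoc, ← Units.val_mul,
        inv_mul_cancel, Units.val_one, mul_one]
      exact Iff.rfl)
    rwa [inv_inv] at h1
  have hκ : ∀ u ∈ (stdChain k).unitGroup s.n,
      cInd (ZK k) Ξ u (cInd (ZK k) Ξ (toGL k κ) (cInd (ZK k) Ξ γ⁻¹ f)) =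
      ψ ((toGL k κ).1 * (γ⁻¹.1 * s.a * γ.1) * (toGL k κ)⁻¹.1 * (u.1 - 1)).trace •
        cInd (ZK k) Ξ (toGL k κ) (cInd (ZK k) Ξ γ⁻¹ f) := by
    intro u hu
    refine cInd_conj_character hstd (toGL k κ) u ?_
    rw [mem_stdChain_unitGroup] at hu ⊢
    have h1 := toGL_conj_entry_mem κ⁻¹ hu
    rw [map_inv, inv_inv] at h1
    convert h1 using 4
    rw [mul_sub, sub_mul, mul_one, Units.val_mul, Units.val_mul, ← Units.val_mul _ (toGL k κ),
      inv_mul_cancel, Units.val_one]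
  have hmem : ∀ i l, ((toGL k κ).1 * (γ⁻¹.1 * s.a * γ.1) * (toGL k κ)⁻¹.1) i l ∈
      fracIdeal k (-(s.n : ℤ)) :=
    toGL_conj_entry_mem κ (mem_stdChain_radPow.1 ((hγ _ _).1 s.mem))
  choose b hb using hmem
  have hbmat : (toGL k κ).1 * (γ⁻¹.1 * s.a * γ.1) * (toGL k κ)⁻¹.1 =
      unif k ^ (-(s.n : ℤ)) • (Matrix.of b).map ιO := Matrix.ext hb
  have hchar : ((Matrix.of b).map PowerSeries.constantCoeff).charpoly =
      (Polynomial.X - Polynomial.C c) ^ 2 := by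
    have h1 : (Matrix.of b).map ιO = (toGL k κ).1 * (γ⁻¹.1 * (unif k ^ s.n • s.a) * γ.1) *
        (toGL k κ)⁻¹.1 := by
      rw [Matrix.mul_smul, Matrix.smul_mul, Matrix.mul_smul, Matrix.smul_mul, hbmat, smul_smul,
        ← zpow_natCast, ← zpow_add₀ (unif_ne_zero k), add_neg_cancel, zpow_zero, one_smul]
    have h2 := congrArg Matrix.charpoly h1
    have h3 := charpoly_conj γ⁻¹ (unif k ^ s.n • s.a)
    rw [inv_inv] at h3
    rw [charpoly_conj, h3, ← hF, Matrix.charpoly_map] at h2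
    have h4 := Polynomial.map_injective _ algebraMap_int_injective h2
    rw [hFc, ← h4, Matrix.charpoly_map]
  rw [hbmat] at hκ
  have hzero := not_transform_of_charpoly_eq hm hN hΞ hψ s.n_pos hκ hc hchar j
  rw [cInd_apply] at hzero
  apply hg
  rw [mul_assoc, cInd_left_mul _ ⟨ζ, hζ⟩, hzero, map_zero]

end Transform

end Strata

end GLTwo

theorem mainTheorem10 {k C W : Type*} [Field k] [Finite k] [Field C] [IsAlgClosed C] [CharZero C]
    [AddCommGroup W] [Module C W] (m : ℕ)
    (ξ : Representation C (GLTwo.FiniteLevel k m) W) (hirr : ξ.IsIrreducible)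
    (hN : ¬ GLTwo.ContainsCharOn ξ (GLTwo.unipFiltration k m m) (fun _ => 1))
    (Ξ : Representation C (GLTwo.ZK k) W)
    (hΞ : ∀ g : GL (Fin 2) k⟦X⟧, Ξ (GLTwo.toZK k g) = ξ (GLTwo.reduction k m g)) :
    (GLTwo.cInd (GLTwo.ZK k) Ξ).IsIrreducible ∧
    GLTwo.IsCuspidal (GLTwo.cInd (GLTwo.ZK k) Ξ) ∧
    GLTwo.IsAdmissible (GLTwo.cInd (GLTwo.ZK k) Ξ) ∧
    (0 < m →
      (∀ ψ : AddChar k⸨X⸩ C, GLTwo.IsLevelOne ψ →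
        (∃ s : GLTwo.Stratum k, s.chain = GLTwo.stdChain k ∧ s.n = m ∧
          s.IsUnramifiedSimple ∧ GLTwo.ContainsStratum ψ (GLTwo.cInd (GLTwo.ZK k) Ξ) s) ∧
        ¬ ∃ s : GLTwo.Stratum k,
          s.IsEssentiallyScalar ∧ GLTwo.ContainsStratum ψ (GLTwo.cInd (GLTwo.ZK k) Ξ) s) ∧
      GLTwo.HasLevel (GLTwo.cInd (GLTwo.ZK k) Ξ) m ∧
      ∀ φ : k⸨X⸩ˣ →* Cˣ, IsOpen (φ.ker : Set k⸨X⸩ˣ) →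
        ∃ r : ℚ, GLTwo.HasLevel (GLTwo.twist φ (GLTwo.cInd (GLTwo.ZK k) Ξ)) r ∧
          0 < (m : ℚ) ∧ (m : ℚ) ≤ r) := by
  have := GLTwo.nontrivial_of_isIrreducible hirr
  refine ⟨GLTwo.cInd_isIrreducible hirr hN hΞ, GLTwo.cInd_isCuspidal hirr hN hΞ,
    GLTwo.cInd_isAdmissible hirr hN hΞ, fun hm => ⟨fun ψ hψ => ⟨?_, ?_⟩, ?_, fun φ hφ => ?_⟩⟩
  · exact GLTwo.exists_unramifiedSimple_stratum hm hN hΞ hψ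
  · rintro ⟨s, hs, hs'⟩
    exact GLTwo.not_containsStratum_of_isEssentiallyScalar hm hN hΞ hψ s hs hs'
  · exact GLTwo.cInd_hasLevel hN hΞ
  · obtain ⟨r, hr, hmr⟩ := GLTwo.exists_hasLevel_twist hN hΞ φ hφ
    exact ⟨r, hr, by exact_mod_cast hm, hmr⟩
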